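/- Let $M$ be a smooth manifold of dimension $n\ge 2$ with a Finsler structure $F:TM\to[0,\infty)$ (smooth on the slit tangent bundle $TM_0$, positively $1$-homogeneous on fibres, with $g_{ij}=[\tfrac12F^2]_{y^iy^j}$ positive definite on $TM_0$). Put $G^i=\tfrac12 g^{il}\{[F^2]_{x^ky^l}y^k-[F^2]_{x^l}\}$, $G^i{}_j=\tfrac12\partial G^i/\partial y^j$, $\frac{\delta}{\delta x^k}=\frac{\partial}{\partial x^k}-G^l{}_k\frac{\partial}{\partial y^l}$, $$F^2\mathrm{Ric}=(G^i)_{x^i}-\tfrac14(G^i)_{y^j}(G^j)_{y^i}-\tfrac12y^j(G^i)_{y^ix^j}+\tfrac12G^j(G^i)_{y^iy^j},\qquad \mathrm{Ric}_{ij}=\tfrac12\,(F^2\mathrm{Ric})_{y^iy^j}.$$ Assume that the Ricci tensor $\mathrm{Ric}_{ij}$ is parallel with respect to the Cartan connection (its horizontal and vertical Cartan covariant derivatives vanish on $TM_0$), or that its horizontal covariant derivative with respect to the Chern connection or with respect to the Berwald connection vanishes on $TM_0$ (in particular, this holds if it is parallel with respect to the Chern or the Berwald connection). Let $I\subseteq\mathbb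 R$ be an open interval and let $x:I\to M$ be a geodesic parametrized by arc length $s$, that is, $\ddot x^i+G^i(x,\dot x)=0$ and $F(x,\dot x)=1$. Then there is a constant $K$ with $\mathrm{Ric}_{jk}(x,\dot x)\,\dot x^j\dot x^k=K$ on $I$. Consequently the projective parameters of the geodesic on an open interval $J\subseteq I$, that is, the $C^3$ functions $p:J\to\mathbb R$ with $p'\neq0$ and $$\{p,s\}:=\frac{p'''}{p'}-\frac32\Big(\frac{p''}{p'}\Big)^2=\frac{2}{n-1}\mathrm{Ric}_{jk}(x,\dot x)\,\dot x^j\dot x^k=\frac{2K}{n-1},$$ are exactly the following functions, where $\alpha,\beta,\gamma,\delta$ are real constants with $\alpha\delta-\beta\gamma\ne0$ such that the denominator has no zero on $J$: (i) if $\frac{2K}{n-1}=2c^2$ with $c>0$: $\displaystyle p=\frac{\alpha\cos(cs)+\beta\sin(cs)}{\gamma\cos(cs)+\delta\sin(cs)}$; (ii) if $\frac{2K}{n-1}=-2c^2$ with $c>0$: $\displaystyle p=\frac{\alpha e^{cs}+\beta e^{-cs}}{\gamma e^{cs}+\delta e^{-cs}}$; (iii) if $\frac{2K}{n-1}=0$: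 $\displaystyle p=\frac{\alpha+\beta s}{\gamma+\delta s}$. -/

import Mathlib

open scoped Manifold ContDiff

noncomputable section

namespace Finsler

/-- The model space `ℝⁿ`. -/
abbrev E (n : ℕ) := EuclideanSpace ℝ (Fin n)

/-! ### Local calculus: functions of `(x, y)`, position and velocity, in a coordinate chart -/

section LocalCalculus

variable {n : ℕ}

/-- `∂f/∂xⁱ` for a function `f` of `(x, y)`. -/
def pdx (i : Fin n) (f : E n × E n → ℝ) (z : E n × E n) : ℝ :=
  fderiv ℝ f z (EuclideanSpace.single i 1, 0)

/-- `∂f/∂yⁱ` for a function `f` of `(x, y)`. -/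
def pdy (i : Fin n) (f : E n × E n → ℝ) (z : E n × E n) : ℝ :=
  fderiv ℝ f z (0, EuclideanSpace.single i 1)

/-- The fundamental tensor `g_ij = ∂²(F²/2)/∂yⁱ∂yʲ`. -/
def fundTensor (L : E n × E n → ℝ) (z : E n × E n) : Matrix (Fin n) (Fin n) ℝ :=
  Matrix.of fun i j => pdy j (pdy i fun w => (1 / 2) * L w ^ 2) z

/-- The inverse `g^ij` of the fundamental tensor. -/
def fundInv (L : E n × E n → ℝ) (z : E n × E n) : Matrix (Fin n) (Fin n) ℝ :=
  (fundTensor L z)⁻¹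

/-- The spray coefficients `Gⁱ = (1/2) g^il ([F²]_{xᵏ yˡ} yᵏ - [F²]_{xˡ})`. With this
normalization the geodesic equation is `x'' + G(x, x') = 0`. -/
def spray (L : E n × E n → ℝ) (i : Fin n) (z : E n × E n) : ℝ :=
  (1 / 2) * ∑ l, fundInv L z i l *
    ((∑ k, pdy l (pdx k fun w => L w ^ 2) z * z.2 k) - pdx l (fun w => L w ^ 2) z)

/-- The nonlinear connection `Gⁱ_j = (1/2) ∂Gⁱ/∂yʲ`. -/
def nonlin (L : E n × E n → ℝ) (i j : Fin n) (z : E n × E n) : ℝ :=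
  (1 / 2) * pdy j (spray L i) z

/-- The horizontal derivative `δ/δxᵏ = ∂/∂xᵏ - Gˡ_k ∂/∂yˡ`. -/
def hder (L : E n × E n → ℝ) (k : Fin n) (f : E n × E n → ℝ) (z : E n × E n) : ℝ :=
  pdx k f z - ∑ l, nonlin L l k z * pdy l f z

/-- The Riemann curvature `F² Rⁱ_k`, homogeneous of degree two in `y`:
`∂Gⁱ/∂xᵏ - (1/4) ∂Gⁱ/∂yʲ ∂Gʲ/∂yᵏ - (1/2) yʲ ∂²Gⁱ/∂yᵏ∂xʲ + (1/2) Gʲ ∂²Gⁱ/∂yᵏ∂yʲ`. -/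
def riemann (L : E n × E n → ℝ) (i k : Fin n) (z : E n × E n) : ℝ :=
  pdx k (spray L i) z
    - (1 / 4) * ∑ j, pdy j (spray L i) z * pdy k (spray L j) z
    - (1 / 2) * ∑ j, z.2 j * pdx j (pdy k (spray L i)) z
    + (1 / 2) * ∑ j, spray L j z * pdy k (pdy j (spray L i)) z

/-- The trace `F² Ric` of the Riemann curvature, where `Ric` is the Ricci scalar. -/
def ricciSq (L : E n × E n → ℝ) (z : E n × E n) : ℝ := ∑ i, riemann L i i z

/-- The Ricci tensor (of Akbar-Zadeh) `Ric_ij = (1/2) ∂²(F² Ric)/∂yⁱ∂yʲ`. -/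
def ricci (L : E n × E n → ℝ) (i j : Fin n) (z : E n × E n) : ℝ :=
  (1 / 2) * pdy j (pdy i (ricciSq L)) z

/-! ### The Cartan, Chern and Berwald connections -/

/-- The local coefficients of a linear connection on the pulled back tangent bundle over the slit
tangent bundle: `hor i j k` are the horizontal and `ver i j k` the vertical coefficients
(`i` the upper index, `k` the index of differentiation along `δ/δxᵏ`, resp. `∂/∂yᵏ`). -/
structure ConnCoeff (n : ℕ) where
  hor : Fin n → Fin n → Fin n → E n × E n → ℝ
  ver : Fin n → Fin n → Fin n → E n × E n → ℝ

/-- `Γⁱ_jk = (1/2) g^ih (δg_hj/δxᵏ + δg_kh/δxʲ - δg_jk/δxʰ)`. -/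
def chernGamma (L : E n × E n → ℝ) (i j k : Fin n) (z : E n × E n) : ℝ :=
  (1 / 2) * ∑ h, fundInv L z i h *
    (hder L k (fun w => fundTensor L w h j) z + hder L j (fun w => fundTensor L w k h) z
      - hder L h (fun w => fundTensor L w j k) z)

/-- The Cartan tensor divided by `F`, index raised: `Aⁱ_jk / F = (1/2) g^ih ∂g_hj/∂yᵏ`. -/
def cartanTensor (L : E n × E n → ℝ) (i j k : Fin n) (z : E n × E n) : ℝ :=
  (1 / 2) * ∑ h, fundInv L z i h * pdy k (fun w => fundTensor L w h j) z

/-- The Cartan connection. -/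
def cartan (L : E n × E n → ℝ) : ConnCoeff n where
  hor := chernGamma L
  ver := cartanTensor L

/-- The Chern connection. -/
def chern (L : E n × E n → ℝ) : ConnCoeff n where
  hor := chernGamma L
  ver := fun _ _ _ _ => 0

/-- The Berwald connection, `Gⁱ_jk = (1/2) ∂²Gⁱ/∂yʲ∂yᵏ`. -/
def berwald (L : E n × E n → ℝ) : ConnCoeff n where
  hor := fun i j k => pdy k (nonlin L i j)
  ver := fun _ _ _ _ => 0

/-- The horizontal covariant derivative along `δ/δxᵏ` of a covariant 2-tensor `T`. -/
def hcov (L : E n × E n → ℝ) (D : ConnCoeff n) (T : Fin n → Fin n → E n × E n → ℝ)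
    (k i j : Fin n) (z : E n × E n) : ℝ :=
  hder L k (T i j) z - (∑ r, T i r z * D.hor r j k z) - ∑ r, T r j z * D.hor r i k z

/-- The vertical covariant derivative along `∂/∂yᵏ` of a covariant 2-tensor `T`. -/
def vcov (D : ConnCoeff n) (T : Fin n → Fin n → E n × E n → ℝ)
    (k i j : Fin n) (z : E n × E n) : ℝ :=
  pdy k (T i j) z - (∑ r, T i r z * D.ver r j k z) - ∑ r, T r j z * D.ver r i k z

end LocalCalculus

/-! ### Finsler manifolds -/

section Manifold

variable {n : ℕ} {M : Type*} [TopologicalSpace M] [ChartedSpace (E n) M]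

/-- A function on the tangent bundle expressed in the coordinates `(x, y)` induced by a chart:
`y` are the components of the tangent vector `yⁱ ∂/∂xⁱ` at the point with coordinates `x`. -/
def localRep (F : TangentBundle (𝓡 n) M → ℝ) (e : OpenPartialHomeomorph M (E n))
    (z : E n × E n) : ℝ :=
  F ⟨e.symm z.1, mfderiv (𝓡 n) (𝓡 n) e.symm z.1 z.2⟩

end Manifold

/-- A Finsler structure on a smooth `n`-manifold `M`. -/
structure FinslerStructure (n : ℕ) (M : Type*) [TopologicalSpace M] [ChartedSpace (E n) M]
    [IsManifold (𝓡 n) ∞ M] where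
  /-- the Finsler function on the tangent bundle -/
  toFun : TangentBundle (𝓡 n) M → ℝ
  nonneg : ∀ v, 0 ≤ toFun v
  /-- regularity on the slit tangent bundle -/
  smooth : ContMDiffOn (𝓡 n).tangent 𝓘(ℝ, ℝ) ∞ toFun {v | v.2 ≠ 0}
  /-- positive homogeneity -/
  homog : ∀ (x : M) (y : TangentSpace (𝓡 n) x) (t : ℝ), 0 < t →
    toFun ⟨x, t • y⟩ = t * toFun ⟨x, y⟩
  /-- strong convexity -/
  convex : ∀ e ∈ atlas (E n) M, ∀ x ∈ e.target, ∀ y : E n, y ≠ 0 →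
    (fundTensor (localRep toFun e) (x, y)).PosDef

namespace FinslerStructure

variable {n : ℕ} {M : Type*} [TopologicalSpace M] [ChartedSpace (E n) M] [IsManifold (𝓡 n) ∞ M]

/-- The Finsler function in the coordinates induced by a chart. -/
def loc (F : FinslerStructure n M) (e : OpenPartialHomeomorph M (E n)) : E n × E n → ℝ :=
  localRep F.toFun e

/-- The horizontal covariant derivative of the Ricci tensor with respect to the connection `D`
vanishes on the slit tangent bundle. -/
def RicciHParallel (F : FinslerStructure n M) (D : (E n × E n → ℝ) → ConnCoeff n) : Prop :=
  ∀ e ∈ atlas (E n) M, ∀ x ∈ e.target, ∀ y : E n, y ≠ 0 → ∀ k i j : Fin n,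
    hcov (F.loc e) (D (F.loc e)) (ricci (F.loc e)) k i j (x, y) = 0

/-- The vertical covariant derivative of the Ricci tensor with respect to the connection `D`
vanishes on the slit tangent bundle. -/
def RicciVParallel (F : FinslerStructure n M) (D : (E n × E n → ℝ) → ConnCoeff n) : Prop :=
  ∀ e ∈ atlas (E n) M, ∀ x ∈ e.target, ∀ y : E n, y ≠ 0 → ∀ k i j : Fin n,
    vcov (D (F.loc e)) (ricci (F.loc e)) k i j (x, y) = 0

/-- The Ricci tensor is parallel with respect to the connection `D`. -/
def RicciParallel (F : FinslerStructure n M) (D : (E n × E n → ℝ) → ConnCoeff n) : Prop :=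
  F.RicciHParallel D ∧ F.RicciVParallel D

/-- `γ`, on the open set `I` of parameters, is a geodesic parametrized by arc length: in every
chart its coordinate expression `x(s)` satisfies `x'' + G(x, x') = 0` and `F(x, x') = 1`. -/
def IsArcLengthGeodesic (F : FinslerStructure n M) (γ : ℝ → M) (I : Set ℝ) : Prop :=
  ContMDiffOn 𝓘(ℝ, ℝ) (𝓡 n) 2 γ I ∧
  ∀ s ∈ I, ∀ e ∈ atlas (E n) M, γ s ∈ e.source →
    (∀ i, deriv (deriv (e ∘ γ)) s i + spray (F.loc e) i (e (γ s), deriv (e ∘ γ) s) = 0) ∧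
    F.loc e (e (γ s), deriv (e ∘ γ) s) = 1

/-- `Ric_jk(x, x') x'ʲ x'ᵏ` at the parameter `s` of the curve `γ`, computed in the chart `e`. -/
def ricciAlong (F : FinslerStructure n M) (γ : ℝ → M) (e : OpenPartialHomeomorph M (E n))
    (s : ℝ) : ℝ :=
  ∑ j, ∑ k, ricci (F.loc e) j k (e (γ s), deriv (e ∘ γ) s) *
    deriv (e ∘ γ) s j * deriv (e ∘ γ) s k

end FinslerStructure

/-- The Schwarzian derivative `{p, s} = p'''/p' - (3/2) (p''/p')²`. -/
def schwarzian (p : ℝ → ℝ) (s : ℝ) : ℝ :=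
  iteratedDeriv 3 p s / deriv p s - (3 / 2) * (iteratedDeriv 2 p s / deriv p s) ^ 2

/-- `p` is a projective parameter of `γ` on the open set `J` of parameters: a `C³` function with
nowhere vanishing derivative such that `{p, s} = 2/(n-1) Ric_jk x'ʲ x'ᵏ` on `J`. -/
def FinslerStructure.IsProjectiveParameter {n : ℕ} {M : Type*} [TopologicalSpace M]
    [ChartedSpace (E n) M] [IsManifold (𝓡 n) ∞ M] (F : FinslerStructure n M)
    (γ : ℝ → M) (J : Set ℝ) (p : ℝ → ℝ) : Prop :=
  ContDiffOn ℝ 3 p J ∧ (∀ s ∈ J, deriv p s ≠ 0) ∧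
  ∀ s ∈ J, ∀ e ∈ atlas (E n) M, γ s ∈ e.source →
    schwarzian p s = 2 / ((n : ℝ) - 1) * F.ricciAlong γ e s

/-- On `J`, `p = (α y₁ + β y₂) / (a y₁ + b y₂)` for constants with `α b - β a ≠ 0`, the
denominator having no zero in `J`. -/
def IsLinFracOf (y₁ y₂ : ℝ → ℝ) (J : Set ℝ) (p : ℝ → ℝ) : Prop :=
  ∃ α β a b : ℝ, α * b - β * a ≠ 0 ∧
    ∀ s ∈ J, a * y₁ s + b * y₂ s ≠ 0 ∧
      p s = (α * y₁ s + β * y₂ s) / (a * y₁ s + b * y₂ s)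

end Finsler

end

namespace Finsler

open Set Filter Topology

/-! ### The Schwarzian equation with constant right-hand side -/

section Schwarzian

/-! The theorem splits into a conservation law along geodesics and a statement about one ordinary
differential equation.

Conservation law. A geodesic lifts to an integral curve of the spray field `(y, -G)`, and `yᵏ δ/δxᵏ`
is differentiation along that field. For each of the three connections the horizontal coefficients
contracted twice with `y` give `G`. Hence if `T_ij` is horizontally parallel, the connection terms
in the derivative of `T_ij yⁱ yʲ` along the spray cancel the terms coming from `y' = -G`
(`fderiv_contraction_eq_zero`). Apply this to the Ricci tensor.

This argument lives in one chart, while a geodesic may cross many. To glue, `Ric_jk yʲ yᵏ` must be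
independent of the chart. By Euler's theorem it equals `F² Ric`, the trace of the Riemann curvature.
The spray is determined by the Euler–Lagrange equation of `F²/2` because the fibre Hessian is
nondegenerate, which yields its transformation law (`spray_tangentLift`). Differentiating that law
shows that the curvature is a tensor (`sprayCurv_tangentLift`), and a trace is invariant under
conjugation (`ricciSq_tangentLift`).

Differential equation. The solutions of `{p, s} = 2λ` with `λ` constant are the quotients of two
independent solutions of `y'' = -λ y`. If `p = u / v` is such a quotient, then `p'` is a constant
multiple of `v⁻²` (`schwarzian_of_isLinFracOf`). Conversely `v = |p'|^(-1/2)` and `p v` both solve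
the linear equation (`isLinFracOf_of_schwarzian`). Explicit fundamental solutions for each sign of
`λ` give the three cases. -/

theorem hasDerivAt_iteratedDeriv_of_contDiffAt {p : ℝ → ℝ} {s : ℝ} (h : ContDiffAt ℝ 3 p s)
    {k : ℕ} (hk : k < 3) : HasDerivAt (iteratedDeriv k p) (iteratedDeriv (k + 1) p s) s := by
  have h1 : ContDiffAt ℝ 1 (iteratedDeriv k p) s := by
    have hc : ∀ (m : ℕ) (q : ℝ → ℝ), ContDiffAt ℝ (m + 1 : ℕ) q s →
        ContDiffAt ℝ m (deriv q) s := by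
      intro m q hq
      have h2 : ContDiffAt ℝ m (fderiv ℝ q) s := hq.fderiv_right (by norm_cast)
      exact h2.clm_apply contDiffAt_const
    have : ∀ k m : ℕ, k + m = 3 → ContDiffAt ℝ m (iteratedDeriv k p) s := by
      intro k
      induction k with
      | zero => intro m hm; obtain rfl : m = 3 := by omega
                simpa using h
      | succ k ih =>
        intro m hm
        rw [iteratedDeriv_succ]
        exact hc m _ (ih (m + 1) (by omega))
    exact (this k (3 - k) (by omega)).of_le (by norm_cast; omega)
  rw [iteratedDeriv_succ]
  exact (h1.differentiableAt (by norm_num)).hasDerivAt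

theorem iteratedDeriv_eq_of_hasDerivAt {p p₁ p₂ p₃ : ℝ → ℝ} {J : Set ℝ} (hJ : IsOpen J)
    (h1 : ∀ s ∈ J, HasDerivAt p (p₁ s) s) (h2 : ∀ s ∈ J, HasDerivAt p₁ (p₂ s) s)
    (h3 : ∀ s ∈ J, HasDerivAt p₂ (p₃ s) s) {s : ℝ} (hs : s ∈ J) :
    deriv p s = p₁ s ∧ iteratedDeriv 2 p s = p₂ s ∧ iteratedDeriv 3 p s = p₃ s := by
  have e1 : ∀ s ∈ J, deriv p =ᶠ[𝓝 s] p₁ := fun s hs => by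
    filter_upwards [hJ.mem_nhds hs] with t ht using (h1 t ht).deriv
  have e2 : ∀ s ∈ J, deriv (deriv p) =ᶠ[𝓝 s] p₂ := fun s hs => by
    filter_upwards [hJ.mem_nhds hs] with t ht
    rw [(e1 t ht).deriv_eq, (h2 t ht).deriv]
  refine ⟨(h1 s hs).deriv, ?_, ?_⟩
  · simp only [iteratedDeriv_succ, iteratedDeriv_zero]; exact (e2 s hs).eq_of_nhds
  · simp only [iteratedDeriv_succ, iteratedDeriv_zero]
    rw [(e2 s hs).deriv_eq, (h3 s hs).deriv]

variable {y₁ y₂ d₁ d₂ : ℝ → ℝ} {lam w : ℝ} {J : Set ℝ}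

/-- The Wronskians of `v` with `y₁` and with `y₂` are constant, and Cramer's rule recovers `v` from
them: `w v = c₂ y₁ - c₁ y₂`. No existence or uniqueness theorem for differential equations is
needed. -/
theorem eq_linear_combination_of_ode (h1 : ∀ s, HasDerivAt y₁ (d₁ s) s)
    (h1' : ∀ s, HasDerivAt d₁ (-lam * y₁ s) s) (h2 : ∀ s, HasDerivAt y₂ (d₂ s) s)
    (h2' : ∀ s, HasDerivAt d₂ (-lam * y₂ s) s) (hw : w ≠ 0)
    (hW : ∀ s, y₁ s * d₂ s - d₁ s * y₂ s = w) (hJ : IsOpen J) (hJc : IsPreconnected J)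
    {v v' : ℝ → ℝ} (hv : ∀ s ∈ J, HasDerivAt v (v' s) s)
    (hv' : ∀ s ∈ J, HasDerivAt v' (-lam * v s) s) :
    ∃ a b : ℝ, ∀ s ∈ J, v s = a * y₁ s + b * y₂ s := by
  have key : ∀ y d : ℝ → ℝ, (∀ s, HasDerivAt y (d s) s) → (∀ s, HasDerivAt d (-lam * y s) s) →
      ∃ c : ℝ, ∀ s ∈ J, v s * d s - v' s * y s = c := by
    intro y d hy hd
    have hder : ∀ s ∈ J, HasDerivAt (fun s => v s * d s - v' s * y s) 0 s := fun s hs => by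
      have := ((hv s hs).mul (hd s)).sub ((hv' s hs).mul (hy s))
      refine this.congr_deriv ?_
      ring
    exact hJ.exists_is_const_of_deriv_eq_zero hJc
      (fun s hs => (hder s hs).differentiableAt.differentiableWithinAt)
      (fun s hs => (hder s hs).deriv)
  obtain ⟨c₁, hc₁⟩ := key y₁ d₁ h1 h1'
  obtain ⟨c₂, hc₂⟩ := key y₂ d₂ h2 h2'
  refine ⟨c₂ / w, -c₁ / w, fun s hs => ?_⟩
  rw [← hc₁ s hs, ← hc₂ s hs]
  field_simp
  rw [← hW s]
  ring

/-- With `v` the denominator, the quotient rule gives `p' = D / v²`, where `D` is constant: up to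
sign, the determinant of the coefficients times the Wronskian `w`. For such a `p` the Schwarzian is
`-2 v'' / v = 2 lam`. -/
theorem schwarzian_of_isLinFracOf (h1 : ∀ s, HasDerivAt y₁ (d₁ s) s)
    (h1' : ∀ s, HasDerivAt d₁ (-lam * y₁ s) s) (h2 : ∀ s, HasDerivAt y₂ (d₂ s) s)
    (h2' : ∀ s, HasDerivAt d₂ (-lam * y₂ s) s) (hc1 : ContDiff ℝ 3 y₁) (hc2 : ContDiff ℝ 3 y₂)
    (hw : w ≠ 0) (hW : ∀ s, y₁ s * d₂ s - d₁ s * y₂ s = w) (hJ : IsOpen J)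
    {p : ℝ → ℝ} (hp : IsLinFracOf y₁ y₂ J p) :
    ContDiffOn ℝ 3 p J ∧ (∀ s ∈ J, deriv p s ≠ 0) ∧ ∀ s ∈ J, schwarzian p s = 2 * lam := by
  obtain ⟨α, β, a, b, hD, h⟩ := hp
  set D : ℝ := (β * a - α * b) * w with hDdef
  have hD0 : D ≠ 0 := mul_ne_zero (by contrapose! hD; linarith) hw
  set v : ℝ → ℝ := fun s => a * y₁ s + b * y₂ s with hv
  set v' : ℝ → ℝ := fun s => a * d₁ s + b * d₂ s with hv'
  have hdv : ∀ s, HasDerivAt v (v' s) s := fun s =>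
    ((h1 s).const_mul a).add ((h2 s).const_mul b)
  have hdv' : ∀ s, HasDerivAt v' (-lam * v s) s := fun s => by
    have := ((h1' s).const_mul a).add ((h2' s).const_mul b)
    refine this.congr_deriv ?_
    simp only [hv]; ring
  have hv0 : ∀ s ∈ J, v s ≠ 0 := fun s hs => (h s hs).1
  have hd1 : ∀ s ∈ J, HasDerivAt p (D / v s ^ 2) s := fun s hs => by
    have h3 := (((h1 s).const_mul α).add ((h2 s).const_mul β)).div (hdv s) (hv0 s hs)
    have h4 : HasDerivAt p _ s := h3.congr_of_eventuallyEq
      (by filter_upwards [hJ.mem_nhds hs] with t ht using (h t ht).2)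
    refine h4.congr_deriv ?_
    congr 1
    simp only [hDdef, ← hW s, hv, hv', Pi.add_apply]
    ring
  have hd2 : ∀ s ∈ J, HasDerivAt (fun s => D / v s ^ 2) (-2 * D * v' s / v s ^ 3) s :=
    fun s hs => by
      have := (hasDerivAt_const s D).div ((hdv s).pow 2) (pow_ne_zero 2 (hv0 s hs))
      refine this.congr_deriv ?_
      have := hv0 s hs
      simp
      field_simp
  have hd3 : ∀ s ∈ J, HasDerivAt (fun s => -2 * D * v' s / v s ^ 3)
      (2 * D * lam / v s ^ 2 + 6 * D * v' s ^ 2 / v s ^ 4) s :=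
    fun s hs => by
      have := ((hdv' s).const_mul (-2 * D)).div ((hdv s).pow 3) (pow_ne_zero 3 (hv0 s hs))
      refine this.congr_deriv ?_
      have := hv0 s hs
      simp
      field_simp
      ring
  refine ⟨?_, fun s hs => ?_, fun s hs => ?_⟩
  · refine ContDiffOn.congr (f := fun s => (α * y₁ s + β * y₂ s) / (a * y₁ s + b * y₂ s)) ?_
      (fun s hs => (h s hs).2)
    refine ContDiffOn.div ?_ ?_ (fun s hs => (h s hs).1)
    · exact ((contDiff_const.mul hc1).add (contDiff_const.mul hc2)).contDiffOn
    · exact ((contDiff_const.mul hc1).add (contDiff_const.mul hc2)).contDiffOn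
  · rw [(hd1 s hs).deriv]
    exact div_ne_zero hD0 (pow_ne_zero 2 (hv0 s hs))
  · obtain ⟨e1, e2, e3⟩ := iteratedDeriv_eq_of_hasDerivAt hJ hd1 hd2 hd3 hs
    have := hv0 s hs
    rw [schwarzian, e1, e2, e3]
    field_simp
    ring

/-- The substitution `v = |p'|^(-1/2)` linearizes the Schwarzian equation: `v` and `p v` both solve
`y'' = -lam y`, so `p` is a quotient of two combinations of `y₁` and `y₂`. -/
theorem isLinFracOf_of_schwarzian (h1 : ∀ s, HasDerivAt y₁ (d₁ s) s)
    (h1' : ∀ s, HasDerivAt d₁ (-lam * y₁ s) s) (h2 : ∀ s, HasDerivAt y₂ (d₂ s) s)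
    (h2' : ∀ s, HasDerivAt d₂ (-lam * y₂ s) s)
    (hw : w ≠ 0) (hW : ∀ s, y₁ s * d₂ s - d₁ s * y₂ s = w) (hJ : IsOpen J)
    (hJc : IsPreconnected J) {p : ℝ → ℝ} (hp : ContDiffOn ℝ 3 p J)
    (hp' : ∀ s ∈ J, deriv p s ≠ 0) (hS : ∀ s ∈ J, schwarzian p s = 2 * lam) :
    IsLinFracOf y₁ y₂ J p := by
  rcases J.eq_empty_or_nonempty with rfl | ⟨s₀, hs₀⟩
  -- On the empty set any constants with nonzero determinant serve.
  · exact ⟨1, 0, 0, 1, by norm_num, fun s hs => hs.elim⟩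
  have hd : ∀ s ∈ J, ∀ k < 3, HasDerivAt (iteratedDeriv k p) (iteratedDeriv (k + 1) p s) s :=
    fun s hs k hk => hasDerivAt_iteratedDeriv_of_contDiffAt (hp.contDiffAt (hJ.mem_nhds hs)) hk
  set q := deriv p with hq
  set q₁ := iteratedDeriv 2 p with hq₁
  set q₂ := iteratedDeriv 3 p with hq₂
  have hdp : ∀ s ∈ J, HasDerivAt p (q s) s := fun s hs => by
    have := hd s hs 0 (by norm_num)
    rwa [iteratedDeriv_zero, zero_add, iteratedDeriv_one] at this
  have hdq : ∀ s ∈ J, HasDerivAt q (q₁ s) s := fun s hs => by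
    have := hd s hs 1 (by norm_num)
    rwa [iteratedDeriv_one] at this
  have hdq₁ : ∀ s ∈ J, HasDerivAt q₁ (q₂ s) s := fun s hs => hd s hs 2 (by norm_num)
  -- By the intermediate value theorem `p'` has constant sign on `J`; `σ = ±1` is that sign, so `σ *
  -- q` is `|p'|`.
  obtain ⟨σ, hpos⟩ : ∃ σ : ℝ, ∀ s ∈ J, 0 < σ * q s := by
    have hcont : ContinuousOn q J := fun s hs => (hdq s hs).continuousAt.continuousWithinAt
    rcases lt_or_gt_of_ne (hp' s₀ hs₀) with hneg | hpos
    · refine ⟨-1, fun s hs => ?_⟩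
      by_contra hcon
      obtain ⟨t, ht, ht0⟩ := hJc.intermediate_value hs₀ hs hcont
        (show (0 : ℝ) ∈ Icc (q s₀) (q s) from ⟨hneg.le, by linarith⟩)
      exact hp' t ht ht0
    · refine ⟨1, fun s hs => ?_⟩
      by_contra hcon
      obtain ⟨t, ht, ht0⟩ := hJc.intermediate_value hs hs₀ hcont
        (show (0 : ℝ) ∈ Icc (q s) (q s₀) from ⟨by linarith, le_of_lt hpos⟩)
      exact hp' t ht ht0
  set v : ℝ → ℝ := fun s => (Real.sqrt (σ * q s))⁻¹ with hv
  have hvpos : ∀ s ∈ J, 0 < v s := fun s hs => inv_pos.2 (Real.sqrt_pos.2 (hpos s hs))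
  have hdv : ∀ s ∈ J, HasDerivAt v (-(1 / 2) * (q₁ s / q s) * v s) s := fun s hs => by
    have hp0 := hpos s hs
    have := (((hdq s hs).const_mul σ).sqrt hp0.ne').inv (Real.sqrt_pos.2 hp0).ne'
    refine this.congr_deriv ?_
    have h5 := (Real.sqrt_pos.2 hp0).ne'
    have h6 := Real.sq_sqrt hp0.le
    have h7 := hp' s hs
    simp only [hv]
    field_simp
    rw [h6]
    ring
  have hdv' : ∀ s ∈ J, HasDerivAt (fun s => -(1 / 2) * (q₁ s / q s) * v s) (-lam * v s) s :=
    fun s hs => by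
      have := ((((hdq₁ s hs).div (hdq s hs) (hp' s hs))).const_mul (-(1 / 2))).mul (hdv s hs)
      refine this.congr_deriv ?_
      have h8 := hS s hs
      have h7 := hp' s hs
      rw [schwarzian] at h8
      simp only [← hq, ← hq₁, ← hq₂] at h7 h8
      -- Here `v''/v = -(1/2) (p''/p')' + (1/4) (p''/p')²`, which is minus half the Schwarzian.
      have h9 : lam = (q₂ s / q s - 3 / 2 * (q₁ s / q s) ^ 2) / 2 := by linarith
      rw [h9]
      simp only [Pi.div_apply]
      field_simp
      ring
  set u' : ℝ → ℝ := fun s => q s * v s + p s * (-(1 / 2) * (q₁ s / q s) * v s) with hu'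
  have hdu : ∀ s ∈ J, HasDerivAt (fun s => p s * v s) (u' s) s :=
    fun s hs => (hdp s hs).mul (hdv s hs)
  -- In `(p v)'' = p'' v + 2 p' v' + p v''` the first two terms cancel, since `v' = -(1/2) (p''/p')
  -- v`.
  have hdu' : ∀ s ∈ J, HasDerivAt u' (-lam * (p s * v s)) s := fun s hs => by
    have := ((hdq s hs).mul (hdv s hs)).add ((hdp s hs).mul (hdv' s hs))
    refine this.congr_deriv ?_
    have h7 := hp' s hs
    field_simp
    ring
  obtain ⟨a, b, hab⟩ := eq_linear_combination_of_ode h1 h1' h2 h2' hw hW hJ hJc hdv hdv'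
  obtain ⟨α, β, hαβ⟩ := eq_linear_combination_of_ode h1 h1' h2 h2' hw hW hJ hJc hdu hdu'
  have hne : ∀ s ∈ J, a * y₁ s + b * y₂ s ≠ 0 := fun s hs => by
    rw [← hab s hs]; exact (hvpos s hs).ne'
  have hpe : ∀ s ∈ J, p s = (α * y₁ s + β * y₂ s) / (a * y₁ s + b * y₂ s) := fun s hs => by
    rw [eq_div_iff (hne s hs), ← hab s hs, hαβ s hs]
  refine ⟨α, β, a, b, fun h0 => ?_, fun s hs => ⟨hne s hs, hpe s hs⟩⟩
  -- If the determinant vanished, `(α, β)` would be a multiple of the nonzero vector `(a, b)`, the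
  -- factor being the orthogonal projection coefficient. Then `p` would be constant, against `p' ≠
  -- 0`.
  have hconst : ∀ s ∈ J, a ^ 2 + b ^ 2 ≠ 0 ∧ p s = (α * a + β * b) / (a ^ 2 + b ^ 2) := by
    intro s hs
    have hab0 : a ^ 2 + b ^ 2 ≠ 0 := by
      intro h
      have ha : a = 0 := by nlinarith [sq_nonneg a, sq_nonneg b]
      have hb : b = 0 := by nlinarith [sq_nonneg a, sq_nonneg b]
      exact hne s hs (by simp [ha, hb])
    refine ⟨hab0, ?_⟩
    rw [hpe s hs, div_eq_div_iff (hne s hs) hab0]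
    linear_combination (b * y₁ s - a * y₂ s) * h0
  have hd0 : HasDerivAt p 0 s₀ := (hasDerivAt_const s₀ _).congr_of_eventuallyEq
    (by filter_upwards [hJ.mem_nhds hs₀] with t ht using (hconst t ht).2)
  exact hp' s₀ hs₀ hd0.deriv

end Schwarzian

/-! ### Behaviour of a spray and its curvature under a change of coordinates -/

section ChangeOfCoordinates

variable {V : Type*} [NormedAddCommGroup V] [NormedSpace ℝ V]

/-- The tangent map of `φ`, in terms of pairs of a position and a velocity. -/
noncomputable def tangentLift (φ : V → V) (z : V × V) : V × V := (φ z.1, fderiv ℝ φ z.1 z.2)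

/-- The Riemann curvature of the spray with coefficients `G`, as an endomorphism. -/
noncomputable def sprayCurv (G : V × V → V) (z : V × V) : V →L[ℝ] V :=
  (fderiv ℝ G z).comp (ContinuousLinearMap.inl ℝ V V)
    - (1 / 4 : ℝ) • ((fderiv ℝ G z).comp (ContinuousLinearMap.inr ℝ V V)).comp
        ((fderiv ℝ G z).comp (ContinuousLinearMap.inr ℝ V V))
    - (1 / 2 : ℝ) • (fderiv ℝ (fderiv ℝ G) z (z.2, -G z)).comp (ContinuousLinearMap.inr ℝ V V)

theorem sprayCurv_apply (G : V × V → V) (z : V × V) (w : V) :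
    sprayCurv G z w = fderiv ℝ G z (w, 0) - (1 / 4 : ℝ) • fderiv ℝ G z (0, fderiv ℝ G z (0, w))
      - (1 / 2 : ℝ) • fderiv ℝ (fderiv ℝ G) z (z.2, -G z) (0, w) := by
  simp [sprayCurv]

variable {φ : V → V} {z : V × V}

theorem hasFDerivAt_comp_fst {W : Type*} [NormedAddCommGroup W] [NormedSpace ℝ W] {f : V → W}
    (hf : DifferentiableAt ℝ f z.1) :
    HasFDerivAt (fun z : V × V => f z.1)
      ((fderiv ℝ f z.1).comp (ContinuousLinearMap.fst ℝ V V)) z :=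
  hf.hasFDerivAt.comp z hasFDerivAt_fst

theorem hasFDerivAt_tangentLift (h0 : DifferentiableAt ℝ φ z.1)
    (h1 : DifferentiableAt ℝ (fderiv ℝ φ) z.1) :
    HasFDerivAt (tangentLift φ) (fderiv ℝ (tangentLift φ) z) z ∧
    ∀ a b, fderiv ℝ (tangentLift φ) z (a, b) =
      (fderiv ℝ φ z.1 a, fderiv ℝ (fderiv ℝ φ) z.1 a z.2 + fderiv ℝ φ z.1 b) := by
  have h := (hasFDerivAt_comp_fst h0).prodMk
    ((hasFDerivAt_comp_fst h1).clm_apply (hasFDerivAt_snd (p := z)))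
  have h' : HasFDerivAt (tangentLift φ) _ z := h
  refine ⟨h'.differentiableAt.hasFDerivAt, fun a b => ?_⟩
  rw [h'.fderiv]
  simp [add_comm]

theorem eventually_comp_fst {X : Type*} [TopologicalSpace X] {z : X × X} {P : X → Prop} (h : ∀ᶠ x in 𝓝 z.1, P x) : ∀ᶠ z' in 𝓝 z, P z'.1 :=
  continuous_fst.continuousAt.eventually h

/-- Transformation law of the coefficients of the geodesic spray. -/
theorem spray_tangentLift {h h' : V × V → ℝ} (hφ : ContDiffAt ℝ 3 φ z.1)
    (hh : ContDiffAt ℝ 2 h z) (hh' : ContDiffAt ℝ 2 h' (tangentLift φ z))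
    (heq : h =ᶠ[𝓝 z] h' ∘ tangentLift φ) {X X' : V}
    (hX : ∀ w, fderiv ℝ (fderiv ℝ h) z (z.2, -X) (0, w) = fderiv ℝ h z (w, 0))
    (hX' : ∀ w, fderiv ℝ (fderiv ℝ h') (tangentLift φ z) ((tangentLift φ z).2, -X') (0, w) =
      fderiv ℝ h' (tangentLift φ z) (w, 0))
    (hnd : ∀ u, (∀ w, fderiv ℝ (fderiv ℝ h') (tangentLift φ z) (0, u) (0, w) = 0) → u = 0)
    (hsurj : Function.Surjective (fderiv ℝ φ z.1)) :
    X' = fderiv ℝ φ z.1 X - fderiv ℝ (fderiv ℝ φ) z.1 z.2 z.2 := by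
  have hφe : ∀ᶠ x in 𝓝 z.1, ContDiffAt ℝ 3 φ x := hφ.eventually (by simp)
  have hd0 : ∀ᶠ z' in 𝓝 z, DifferentiableAt ℝ φ z'.1 := eventually_comp_fst
    (hφe.mono fun x hx => hx.differentiableAt (by norm_num))
  have hd1 : ∀ᶠ z' in 𝓝 z, DifferentiableAt ℝ (fderiv ℝ φ) z'.1 := eventually_comp_fst
    (hφe.mono fun x hx => (hx.fderiv_right (m := 2) (by norm_num)).differentiableAt (by norm_num))
  have hL := hasFDerivAt_tangentLift hd0.self_of_nhds hd1.self_of_nhds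
  have hsymm : IsSymmSndFDerivAt ℝ φ z.1 := hφ.isSymmSndFDerivAt (by simp; norm_num)
  have hh'd : ∀ᶠ z' in 𝓝 z, DifferentiableAt ℝ h' (tangentLift φ z') :=
    hL.1.continuousAt.eventually ((hh'.eventually (by simp)).mono
      fun x hx => hx.differentiableAt (by norm_num))
  -- The chain rule for `h = h' ∘ tangentLift φ` is kept on a neighbourhood, because it is
  -- differentiated once more in `key`.
  have hder : ∀ᶠ z' in 𝓝 z, ∀ a b, fderiv ℝ h z' (a, b) = fderiv ℝ h' (tangentLift φ z')
      (fderiv ℝ φ z'.1 a, fderiv ℝ (fderiv ℝ φ) z'.1 a z'.2 + fderiv ℝ φ z'.1 b) := by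
    filter_upwards [heq.eventuallyEq_nhds, hd0, hd1, hh'd] with z' he h0 h1 h2 a b
    rw [he.fderiv_eq]
    have hL' := hasFDerivAt_tangentLift h0 h1
    rw [(h2.hasFDerivAt.comp z' hL'.1).fderiv, ContinuousLinearMap.comp_apply, hL'.2]
  have hD : DifferentiableAt ℝ (fderiv ℝ h) z :=
    (hh.fderiv_right (m := 1) (by norm_num)).differentiableAt (by norm_num)
  have hD' : DifferentiableAt ℝ (fderiv ℝ h') (tangentLift φ z) :=
    (hh'.fderiv_right (m := 1) (by norm_num)).differentiableAt (by norm_num)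
  have key : ∀ w, fderiv ℝ (fderiv ℝ h) z (z.2, -X) (0, w) =
      fderiv ℝ (fderiv ℝ h') (tangentLift φ z)
        (fderiv ℝ φ z.1 z.2, fderiv ℝ (fderiv ℝ φ) z.1 z.2 z.2 - fderiv ℝ φ z.1 X)
        (0, fderiv ℝ φ z.1 w)
      + fderiv ℝ h' (tangentLift φ z) (0, fderiv ℝ (fderiv ℝ φ) z.1 z.2 w) := by
    intro w
    have e1 := hD.hasFDerivAt.clm_apply (hasFDerivAt_const ((0 : V), w) z)
    have e2 := (hD'.hasFDerivAt.comp z hL.1).clm_apply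
      ((hasFDerivAt_const (0 : V) z).prodMk
        ((hasFDerivAt_comp_fst hd1.self_of_nhds).clm_apply (hasFDerivAt_const w z)))
    have e3 : (fun z' => fderiv ℝ h z' (0, w)) =ᶠ[𝓝 z]
        fun z' => fderiv ℝ h' (tangentLift φ z') (0, fderiv ℝ φ z'.1 w) := by
      filter_upwards [hder] with z' hz'
      simp [hz']
    have e4 := (e2.congr_of_eventuallyEq e3).unique e1
    have e5 := DFunLike.congr_fun e4 (z.2, -X)
    simp [hL.2] at e5
    rw [← e5, sub_eq_add_neg]
    ring
  have hz := hder.self_of_nhds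
  -- The image of `(y, -X)` under the derivative of `tangentLift φ` and the vector `(y', -X')`
  -- differ by a vertical vector. The two Euler–Lagrange equations show that the fibre Hessian of
  -- `h'` annihilates it: the leftover terms in `D²φ` agree by symmetry. Nondegeneracy then makes it
  -- zero.
  have hfin : X' + fderiv ℝ (fderiv ℝ φ) z.1 z.2 z.2 - fderiv ℝ φ z.1 X = 0 := by
    refine hnd _ fun w' => ?_
    obtain ⟨w, rfl⟩ := hsurj w'
    have k1 := key w
    rw [hX w, hz w 0, map_zero, add_zero] at k1
    have k2 := hX' (fderiv ℝ φ z.1 w)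
    have k3 : fderiv ℝ h' (tangentLift φ z) (fderiv ℝ φ z.1 w, fderiv ℝ (fderiv ℝ φ) z.1 w z.2) =
        fderiv ℝ h' (tangentLift φ z) (fderiv ℝ φ z.1 w, 0) +
        fderiv ℝ h' (tangentLift φ z) (0, fderiv ℝ (fderiv ℝ φ) z.1 w z.2) := by
      rw [← map_add]; simp
    have k4 : ((0 : V), X' + fderiv ℝ (fderiv ℝ φ) z.1 z.2 z.2 - fderiv ℝ φ z.1 X) =
        (fderiv ℝ φ z.1 z.2, fderiv ℝ (fderiv ℝ φ) z.1 z.2 z.2 - fderiv ℝ φ z.1 X)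
        - ((tangentLift φ z).2, -X') := by
      ext1
      · simp [tangentLift]
      · simp only [Prod.snd_sub]; abel
    rw [k4, map_sub, sub_apply, k2]
    rw [k3, hsymm.eq w z.2] at k1
    linarith
  rw [eq_sub_iff_add_eq]
  exact sub_eq_zero.1 hfin

/-- The Riemann curvature of a spray is a tensor. -/
theorem sprayCurv_tangentLift {G G' : V × V → V} (hφ : ContDiffAt ℝ 4 φ z.1)
    (hG : ContDiffAt ℝ 2 G z) (hG' : ContDiffAt ℝ 2 G' (tangentLift φ z))
    (heq : ∀ᶠ z' in 𝓝 z, G' (tangentLift φ z') =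
      fderiv ℝ φ z'.1 (G z') - fderiv ℝ (fderiv ℝ φ) z'.1 z'.2 z'.2) (w : V) :
    sprayCurv G' (tangentLift φ z) (fderiv ℝ φ z.1 w) = fderiv ℝ φ z.1 (sprayCurv G z w) := by
  have hφe : ∀ᶠ x in 𝓝 z.1, ContDiffAt ℝ 4 φ x := hφ.eventually (by simp)
  have hd0 : ∀ᶠ z' in 𝓝 z, DifferentiableAt ℝ φ z'.1 := eventually_comp_fst
    (hφe.mono fun x hx => hx.differentiableAt (by norm_num))
  have hd1 : ∀ᶠ z' in 𝓝 z, DifferentiableAt ℝ (fderiv ℝ φ) z'.1 := eventually_comp_fst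
    (hφe.mono fun x hx => (hx.fderiv_right (m := 3) (by norm_num)).differentiableAt (by norm_num))
  have hd2 : ∀ᶠ z' in 𝓝 z, DifferentiableAt ℝ (fderiv ℝ (fderiv ℝ φ)) z'.1 := eventually_comp_fst
    (hφe.mono fun x hx => ((hx.fderiv_right (m := 3) (by norm_num)).fderiv_right (m := 2)
      (by norm_num)).differentiableAt (by norm_num))
  have hL := hasFDerivAt_tangentLift hd0.self_of_nhds hd1.self_of_nhds
  have hsymme : ∀ᶠ x in 𝓝 z.1, ∀ a b, fderiv ℝ (fderiv ℝ φ) x a b = fderiv ℝ (fderiv ℝ φ) x b a :=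
    hφe.mono fun x hx => (hx.isSymmSndFDerivAt (by simp; norm_num)).eq
  have hB := hsymme.self_of_nhds
  have hC1 : ∀ a b c, fderiv ℝ (fderiv ℝ (fderiv ℝ φ)) z.1 a b c =
      fderiv ℝ (fderiv ℝ (fderiv ℝ φ)) z.1 b a c := fun a b c => by
    have hs : IsSymmSndFDerivAt ℝ (fderiv ℝ φ) z.1 :=
      (hφ.fderiv_right (m := 3) (by norm_num)).isSymmSndFDerivAt (by simp; norm_num)
    rw [hs.eq a b]
  -- Symmetry in the last two slots comes from differentiating the symmetry of `D²φ`, which holds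
  -- near the point.
  have hC2 : ∀ a b c, fderiv ℝ (fderiv ℝ (fderiv ℝ φ)) z.1 a b c =
      fderiv ℝ (fderiv ℝ (fderiv ℝ φ)) z.1 a c b := fun a b c => by
    have h2 := hd2.self_of_nhds.hasFDerivAt
    have e1 := (h2.clm_apply (hasFDerivAt_const b z.1)).clm_apply (hasFDerivAt_const c z.1)
    have e2 := (h2.clm_apply (hasFDerivAt_const c z.1)).clm_apply (hasFDerivAt_const b z.1)
    have e3 := DFunLike.congr_fun (e1.unique (e2.congr_of_eventuallyEq
      (hsymme.mono fun x hx => hx b c))) a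
    simpa using e3
  have hGe : ∀ᶠ z' in 𝓝 z, DifferentiableAt ℝ G z' :=
    (hG.eventually (by simp)).mono fun x hx => hx.differentiableAt (by norm_num)
  have hGe' : ∀ᶠ z' in 𝓝 z, DifferentiableAt ℝ G' (tangentLift φ z') :=
    hL.1.continuousAt.eventually ((hG'.eventually (by simp)).mono
      fun x hx => hx.differentiableAt (by norm_num))
  have hder : ∀ᶠ z' in 𝓝 z, ∀ a b, fderiv ℝ G' (tangentLift φ z')
      (fderiv ℝ φ z'.1 a, fderiv ℝ (fderiv ℝ φ) z'.1 a z'.2 + fderiv ℝ φ z'.1 b) =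
      fderiv ℝ (fderiv ℝ φ) z'.1 a (G z') + fderiv ℝ φ z'.1 (fderiv ℝ G z' (a, b))
      - (fderiv ℝ (fderiv ℝ (fderiv ℝ φ)) z'.1 a z'.2 z'.2 + fderiv ℝ (fderiv ℝ φ) z'.1 b z'.2
        + fderiv ℝ (fderiv ℝ φ) z'.1 z'.2 b) := by
    filter_upwards [heq.eventually_nhds, hd0, hd1, hd2, hGe, hGe'] with z' he h0 h1 h2 g g' a b
    have hL' := hasFDerivAt_tangentLift h0 h1
    have e1 := g'.hasFDerivAt.comp z' hL'.1
    have e2 := ((hasFDerivAt_comp_fst h1).clm_apply g.hasFDerivAt).sub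
      (((hasFDerivAt_comp_fst h2).clm_apply (hasFDerivAt_snd (p := z'))).clm_apply
        (hasFDerivAt_snd (p := z')))
    have e3 := e1.unique (e2.congr_of_eventuallyEq he)
    have e4 := DFunLike.congr_fun e3 (a, b)
    simp [hL'.2] at e4
    rw [e4]
    abel
  have hD : DifferentiableAt ℝ (fderiv ℝ G) z :=
    (hG.fderiv_right (m := 1) (by norm_num)).differentiableAt (by norm_num)
  have hD' : DifferentiableAt ℝ (fderiv ℝ G') (tangentLift φ z) :=
    (hG'.fderiv_right (m := 1) (by norm_num)).differentiableAt (by norm_num)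
  have hz := hder.self_of_nhds
  -- The vertical derivative of the transformation law: an affine rule with inhomogeneous term `-2
  -- D²φ(y, u)`.
  have hv : ∀ u, fderiv ℝ G' (tangentLift φ z) (0, fderiv ℝ φ z.1 u) =
      fderiv ℝ φ z.1 (fderiv ℝ G z (0, u)) - (2 : ℝ) • fderiv ℝ (fderiv ℝ φ) z.1 z.2 u := by
    intro u
    have := hz 0 u
    simp only [map_zero, zero_apply, zero_add] at this
    rw [this, hB u z.2]
    module
  -- Differentiate the vertical law along the spray `(y, -G)`, which the derivative of `tangentLift
  -- φ` carries to the spray `(y', -G')`.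
  have key : fderiv ℝ (fderiv ℝ G') (tangentLift φ z)
        ((tangentLift φ z).2, -G' (tangentLift φ z)) (0, fderiv ℝ φ z.1 w)
      + fderiv ℝ G' (tangentLift φ z) (0, fderiv ℝ (fderiv ℝ φ) z.1 z.2 w) =
      fderiv ℝ (fderiv ℝ φ) z.1 z.2 (fderiv ℝ G z (0, w))
      + fderiv ℝ φ z.1 (fderiv ℝ (fderiv ℝ G) z (z.2, -G z) (0, w))
      - (2 : ℝ) • fderiv ℝ (fderiv ℝ (fderiv ℝ φ)) z.1 w z.2 z.2
      + (2 : ℝ) • fderiv ℝ (fderiv ℝ φ) z.1 w (G z) := by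
    have e0 := (hD'.hasFDerivAt.comp z hL.1).clm_apply
      ((hasFDerivAt_const (0 : V) z).prodMk
        ((hasFDerivAt_comp_fst hd1.self_of_nhds).clm_apply (hasFDerivAt_const w z)))
    have e1 := (hasFDerivAt_comp_fst hd1.self_of_nhds).clm_apply
      (hD.hasFDerivAt.clm_apply (hasFDerivAt_const ((0 : V), w) z))
    have h2 := hasFDerivAt_comp_fst hd2.self_of_nhds
    have e2 := (h2.clm_apply (hasFDerivAt_const w z)).clm_apply (hasFDerivAt_snd (p := z))
    have e3 := (h2.clm_apply (hasFDerivAt_snd (p := z))).clm_apply (hasFDerivAt_const w z)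
    have e4 : (fun z' => fderiv ℝ G' (tangentLift φ z') (0, fderiv ℝ φ z'.1 w)) =ᶠ[𝓝 z]
        fun z' => fderiv ℝ φ z'.1 (fderiv ℝ G z' (0, w))
          - (fderiv ℝ (fderiv ℝ φ) z'.1 w z'.2 + fderiv ℝ (fderiv ℝ φ) z'.1 z'.2 w) := by
      filter_upwards [hder] with z' hz'
      simpa using hz' 0 w
    have e5 := e0.unique ((e1.sub (e2.add e3)).congr_of_eventuallyEq e4)
    have e6 := DFunLike.congr_fun e5 (z.2, -G z)
    simp [hL.2] at e6
    have e7 : ((tangentLift φ z).2, -G' (tangentLift φ z)) = (fderiv ℝ φ z.1 z.2,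
        fderiv ℝ (fderiv ℝ φ) z.1 z.2 z.2 + -fderiv ℝ φ z.1 (G z)) := by
      rw [heq.self_of_nhds]
      ext1
      · rfl
      · simp only; abel
    rw [e7, add_comm, e6, hC2 z.2 z.2 w, hC1 z.2 w z.2, hB (G z) w]
    module
  have hw0 := hz w 0
  simp only [map_zero, zero_apply, add_zero] at hw0
  have hw1 : fderiv ℝ G' (tangentLift φ z) (fderiv ℝ φ z.1 w, 0) =
      fderiv ℝ (fderiv ℝ φ) z.1 w (G z) + fderiv ℝ φ z.1 (fderiv ℝ G z (w, 0))
      - fderiv ℝ (fderiv ℝ (fderiv ℝ φ)) z.1 w z.2 z.2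
      - fderiv ℝ G' (tangentLift φ z) (0, fderiv ℝ (fderiv ℝ φ) z.1 z.2 w) := by
    rw [← hw0, ← map_sub, hB w z.2]
    simp
  have hlin : ∀ (a b : V) (c : ℝ), fderiv ℝ G' (tangentLift φ z) (0, a - c • b) =
      fderiv ℝ G' (tangentLift φ z) (0, a) - c • fderiv ℝ G' (tangentLift φ z) (0, b) := by
    intro a b c
    rw [← map_smul, ← map_sub]
    simp
  rw [← eq_sub_iff_add_eq] at key
  -- After substitution all terms in `D²φ` and `D³φ` cancel; the factors `1/4` and `1/2` in the
  -- curvature are exactly what this requires.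
  rw [sprayCurv_apply, sprayCurv_apply, key, hw1, hv w, hlin, hv]
  simp only [map_sub, map_smul]
  module

end ChangeOfCoordinates

/-! ### Partial derivatives, smoothness and homogeneity in coordinates -/

section CoordinateCalculus

variable {n : ℕ}

theorem sum_smul_single (v : E n) : ∑ j, v j • (EuclideanSpace.single j (1 : ℝ) : E n) = v := by
  have := (EuclideanSpace.basisFun (Fin n) ℝ).sum_repr v
  simpa using this

theorem sum_mul_pdx (f : E n × E n → ℝ) (z : E n × E n) (v : E n) :
    ∑ j, v j * pdx j f z = fderiv ℝ f z (v, 0) := by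
  have h : (v, (0 : E n)) = ContinuousLinearMap.inl ℝ (E n) (E n) v := by simp
  rw [h]
  nth_rw 2 [← sum_smul_single v]
  simp only [pdx, map_sum, map_smul, smul_eq_mul, ContinuousLinearMap.inl_apply]

theorem sum_mul_pdy (f : E n × E n → ℝ) (z : E n × E n) (v : E n) :
    ∑ j, v j * pdy j f z = fderiv ℝ f z (0, v) := by
  have h : ((0 : E n), v) = ContinuousLinearMap.inr ℝ (E n) (E n) v := by simp
  rw [h]
  nth_rw 2 [← sum_smul_single v]
  simp only [pdy, map_sum, map_smul, smul_eq_mul, ContinuousLinearMap.inr_apply]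

theorem fderiv_pdx {f : E n × E n → ℝ} {z : E n × E n} (hf : ContDiffAt ℝ 2 f z) (k : Fin n)
    (u : E n × E n) :
    fderiv ℝ (pdx k f) z u = fderiv ℝ (fderiv ℝ f) z u (EuclideanSpace.single k 1, 0) := by
  have hD : DifferentiableAt ℝ (fderiv ℝ f) z :=
    (hf.fderiv_right (m := 1) (by norm_num)).differentiableAt (by norm_num)
  have e1 : HasFDerivAt (pdx k f) _ z :=
    hD.hasFDerivAt.clm_apply (hasFDerivAt_const ((EuclideanSpace.single k 1 : E n), (0 : E n)) z)
  rw [e1.fderiv]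
  simp

theorem fderiv_pdy {f : E n × E n → ℝ} {z : E n × E n} (hf : ContDiffAt ℝ 2 f z) (k : Fin n)
    (u : E n × E n) :
    fderiv ℝ (pdy k f) z u = fderiv ℝ (fderiv ℝ f) z u (0, EuclideanSpace.single k 1) := by
  have hD : DifferentiableAt ℝ (fderiv ℝ f) z :=
    (hf.fderiv_right (m := 1) (by norm_num)).differentiableAt (by norm_num)
  have e1 : HasFDerivAt (pdy k f) _ z :=
    hD.hasFDerivAt.clm_apply (hasFDerivAt_const ((0 : E n), (EuclideanSpace.single k 1 : E n)) z)
  rw [e1.fderiv]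
  simp

theorem pdy_pdx_comm {f : E n × E n → ℝ} {z : E n × E n} (hf : ContDiffAt ℝ 2 f z)
    (k l : Fin n) : pdy l (pdx k f) z = pdx k (pdy l f) z := by
  rw [pdy, fderiv_pdx hf, pdx, fderiv_pdy hf]
  exact (hf.isSymmSndFDerivAt (by simp)).eq _ _

theorem pdy_pdy_comm {f : E n × E n → ℝ} {z : E n × E n} (hf : ContDiffAt ℝ 2 f z)
    (k l : Fin n) : pdy l (pdy k f) z = pdy k (pdy l f) z := by
  rw [pdy, fderiv_pdy hf, pdy, fderiv_pdy hf]
  exact (hf.isSymmSndFDerivAt (by simp)).eq _ _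

theorem pdx_const_mul (c : ℝ) (f : E n × E n → ℝ) (k : Fin n) (z : E n × E n) :
    pdx k (fun w => c * f w) z = c * pdx k f z := by
  simp only [pdx]
  have h : (fun w => c * f w) = c • f := rfl
  rw [h, fderiv_const_smul_field]; simp

theorem pdy_const_mul (c : ℝ) (f : E n × E n → ℝ) (k : Fin n) (z : E n × E n) :
    pdy k (fun w => c * f w) z = c * pdy k f z := by
  simp only [pdy]
  have h : (fun w => c * f w) = c • f := rfl
  rw [h, fderiv_const_smul_field]; simp

/-! #### Smoothness -/

theorem contDiffOn_pdx {f : E n × E n → ℝ} {Ω : Set (E n × E n)} (hΩ : IsOpen Ω)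
    (hf : ContDiffOn ℝ ∞ f Ω) (k : Fin n) : ContDiffOn ℝ ∞ (pdx k f) Ω :=
  (hf.fderiv_of_isOpen hΩ (by simp)).clm_apply contDiffOn_const

theorem contDiffOn_pdy {f : E n × E n → ℝ} {Ω : Set (E n × E n)} (hΩ : IsOpen Ω)
    (hf : ContDiffOn ℝ ∞ f Ω) (k : Fin n) : ContDiffOn ℝ ∞ (pdy k f) Ω :=
  (hf.fderiv_of_isOpen hΩ (by simp)).clm_apply contDiffOn_const

theorem contDiffOn_snd_apply {Ω : Set (E n × E n)} (k : Fin n) :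
    ContDiffOn ℝ ∞ (fun z : E n × E n => z.2 k) Ω :=
  ((EuclideanSpace.proj (𝕜 := ℝ) k).contDiff.comp contDiff_snd).contDiffOn

theorem contDiffOn_det {X : Type*} [NormedAddCommGroup X] [NormedSpace ℝ X]
    {A : X → Matrix (Fin n) (Fin n) ℝ} {Ω : Set X}
    (hA : ∀ i j, ContDiffOn ℝ ∞ (fun z => A z i j) Ω) :
    ContDiffOn ℝ ∞ (fun z => (A z).det) Ω := by
  simp only [Matrix.det_apply']
  exact ContDiffOn.sum fun σ _ => contDiffOn_const.mul (contDiffOn_prod fun i _ => hA _ _)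

/-- Cramer's rule writes each entry as a quotient of determinants, which are polynomials in the
entries of `A`. -/
theorem contDiffOn_inv_apply {X : Type*} [NormedAddCommGroup X] [NormedSpace ℝ X]
    {A : X → Matrix (Fin n) (Fin n) ℝ} {Ω : Set X}
    (hA : ∀ i j, ContDiffOn ℝ ∞ (fun z => A z i j) Ω) (hdet : ∀ z ∈ Ω, (A z).det ≠ 0)
    (i j : Fin n) : ContDiffOn ℝ ∞ (fun z => (A z)⁻¹ i j) Ω := by
  have h : ∀ z, (A z)⁻¹ i j = (A z).det⁻¹ * ((A z).updateRow j (Pi.single i 1)).det := fun z => by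
    rw [Matrix.inv_def, Ring.inverse_eq_inv', Matrix.smul_apply, Matrix.adjugate_apply, smul_eq_mul]
  simp only [h]
  refine ((contDiffOn_det hA).inv hdet).mul (contDiffOn_det fun k l => ?_)
  by_cases hk : k = j
  · simp only [Matrix.updateRow_apply, hk, if_true]
    exact contDiffOn_const
  · simp only [Matrix.updateRow_apply, hk, if_false]
    exact hA k l

/-! #### Homogeneity in the velocity -/

/-- `f` is positively homogeneous of degree `p` in the velocity. -/
def IsHomog (p : ℤ) (f : E n × E n → ℝ) : Prop :=
  ∀ (x y : E n) (t : ℝ), 0 < t → f (x, t • y) = t ^ p * f (x, y)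

namespace IsHomog

variable {p q : ℤ} {f g : E n × E n → ℝ}

theorem mul (hf : IsHomog p f) (hg : IsHomog q g) : IsHomog (p + q) fun z => f z * g z :=
  fun x y t ht => by
    simp only [hf x y t ht, hg x y t ht, zpow_add₀ ht.ne']; ring

theorem add (hf : IsHomog p f) (hg : IsHomog p g) : IsHomog p fun z => f z + g z :=
  fun x y t ht => by simp only [hf x y t ht, hg x y t ht]; ring

theorem sub (hf : IsHomog p f) (hg : IsHomog p g) : IsHomog p fun z => f z - g z :=
  fun x y t ht => by simp only [hf x y t ht, hg x y t ht]; ring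

theorem const_mul (c : ℝ) (hf : IsHomog p f) : IsHomog p fun z => c * f z :=
  fun x y t ht => by simp only [hf x y t ht]; ring

theorem sum {ι : Type*} {s : Finset ι} {f : ι → E n × E n → ℝ} (hf : ∀ i, IsHomog p (f i)) :
    IsHomog p fun z => ∑ i ∈ s, f i z :=
  fun x y t ht => by simp only [fun i => hf i x y t ht, Finset.mul_sum]

theorem snd_apply (k : Fin n) : IsHomog 1 fun z : E n × E n => z.2 k :=
  fun x y t ht => by simp

/-- Since `(x, y) ↦ (x, t y)` is a linear equivalence, the chain rule needs no differentiability of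
`f`: otherwise both sides are the default value zero. So homogeneity passes to every derived
quantity without restricting the domain. -/
theorem fderiv_scale (hf : IsHomog p f) (x y : E n) {t : ℝ} (ht : 0 < t) (a b : E n) :
    fderiv ℝ f (x, t • y) (a, t • b) = t ^ p * fderiv ℝ f (x, y) (a, b) := by
  let iso : (E n × E n) ≃L[ℝ] (E n × E n) :=
    (ContinuousLinearEquiv.refl ℝ (E n)).prodCongr
      (ContinuousLinearEquiv.smulLeft (Units.mk0 t ht.ne'))
  have hiso : ∀ z, iso z = (z.1, t • z.2) := fun z => rfl
  have h1 : f ∘ iso = (t ^ p) • f := by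
    ext z
    simp only [Function.comp_apply, hiso, Pi.smul_apply, smul_eq_mul]
    exact hf z.1 z.2 t ht
  have h2 := iso.comp_right_fderiv (f := f) (x := (x, y))
  rw [h1, fderiv_const_smul_field] at h2
  have h3 := DFunLike.congr_fun h2 (a, b)
  simpa [hiso] using h3.symm

theorem pdx (hf : IsHomog p f) (k : Fin n) : IsHomog p (pdx k f) := fun x y t ht => by
  have := hf.fderiv_scale x y ht (EuclideanSpace.single k 1) 0
  rwa [smul_zero] at this

theorem pdy (hf : IsHomog p f) (k : Fin n) : IsHomog (p - 1) (pdy k f) := fun x y t ht => by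
  have := hf.fderiv_scale x y ht 0 (EuclideanSpace.single k 1)
  have h2 : ((0 : E n), t • (EuclideanSpace.single k (1 : ℝ) : E n)) =
      t • ((0 : E n), (EuclideanSpace.single k (1 : ℝ) : E n)) := by simp
  rw [h2, map_smul, smul_eq_mul] at this
  rw [Finsler.pdy, Finsler.pdy, zpow_sub_one₀ ht.ne', mul_right_comm, ← this]
  field_simp

/-- Euler's theorem: differentiate `f (x, t y) = t ^ p f (x, y)` at `t = 1`. -/
theorem euler (hf : IsHomog p f) {z : E n × E n} (hd : DifferentiableAt ℝ f z) :
    fderiv ℝ f z (0, z.2) = p * f z := by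
  have hc : HasDerivAt (fun t : ℝ => (z.1, t • z.2)) ((0 : E n), z.2) 1 := by
    have h2 := (hasDerivAt_id (1 : ℝ)).smul_const z.2
    simp only [one_smul, id] at h2
    exact (hasDerivAt_const (1 : ℝ) z.1).prodMk h2
  have hd' : HasFDerivAt f (fderiv ℝ f z) ((fun t : ℝ => (z.1, t • z.2)) 1) := by
    simpa using hd.hasFDerivAt
  have h1 := hd'.comp_hasDerivAt (1 : ℝ) hc
  have h3 : HasDerivAt (fun t : ℝ => t ^ p * f z) (p * f z) 1 := by
    have := (hasDerivAt_zpow p (1 : ℝ) (Or.inl one_ne_zero)).mul_const (f z)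
    simpa using this
  refine (h1.congr_of_eventuallyEq ?_).unique h3 |>.symm ▸ rfl
  filter_upwards [lt_mem_nhds (zero_lt_one (α := ℝ))] with t ht
  exact (hf z.1 z.2 t ht).symm

theorem sum_mul_pdy (hf : IsHomog p f) {z : E n × E n} (hd : DifferentiableAt ℝ f z) :
    ∑ j, z.2 j * Finsler.pdy j f z = p * f z := by
  rw [Finsler.sum_mul_pdy, hf.euler hd]

end IsHomog

end CoordinateCalculus

/-! ### The spray and curvature of a Finsler function in a chart -/

section LocalFinsler

variable {n : ℕ}

/-- A Finsler function on an open set `U` of `ℝⁿ`. -/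
structure IsLocalFinsler (U : Set (E n)) (L : E n × E n → ℝ) : Prop where
  isOpen : IsOpen U
  smooth : ContDiffOn ℝ ∞ L (U ×ˢ {0}ᶜ)
  homog : IsHomog 1 L
  posDef : ∀ z ∈ U ×ˢ {0}ᶜ, (fundTensor L z).PosDef

/-- Half the square of a Finsler function. -/
noncomputable def energy (L : E n × E n → ℝ) (z : E n × E n) : ℝ := (1 / 2) * L z ^ 2

/-- The spray coefficients as a vector. -/
noncomputable def sprayVec (L : E n × E n → ℝ) (z : E n × E n) : E n :=
  WithLp.toLp 2 fun i => spray L i z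

theorem sq_eq_two_mul_energy (L : E n × E n → ℝ) :
    (fun w => L w ^ 2) = fun w => 2 * energy L w := by
  funext w; simp only [energy]; ring

namespace IsLocalFinsler

variable {U : Set (E n)} {L : E n × E n → ℝ} {z : E n × E n}

theorem isOpen_slit (hL : IsLocalFinsler U L) : IsOpen (U ×ˢ ({0}ᶜ : Set (E n))) :=
  hL.isOpen.prod isOpen_compl_singleton

theorem contDiffOn_sq (hL : IsLocalFinsler U L) :
    ContDiffOn ℝ ∞ (fun w => L w ^ 2) (U ×ˢ {0}ᶜ) := hL.smooth.pow 2

theorem contDiffOn_energy (hL : IsLocalFinsler U L) :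
    ContDiffOn ℝ ∞ (energy L) (U ×ˢ {0}ᶜ) := contDiffOn_const.mul hL.contDiffOn_sq

theorem contDiffOn_fundTensor (hL : IsLocalFinsler U L) (i j : Fin n) :
    ContDiffOn ℝ ∞ (fun w => fundTensor L w i j) (U ×ˢ {0}ᶜ) :=
  contDiffOn_pdy hL.isOpen_slit (contDiffOn_pdy hL.isOpen_slit hL.contDiffOn_energy i) j

theorem det_ne_zero (hL : IsLocalFinsler U L) (hz : z ∈ U ×ˢ {0}ᶜ) : (fundTensor L z).det ≠ 0 :=
  (hL.posDef z hz).det_pos.ne'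

theorem contDiffOn_fundInv (hL : IsLocalFinsler U L) (i j : Fin n) :
    ContDiffOn ℝ ∞ (fun w => fundInv L w i j) (U ×ˢ {0}ᶜ) :=
  contDiffOn_inv_apply hL.contDiffOn_fundTensor (fun _ hz => hL.det_ne_zero hz) i j

theorem contDiffOn_spray (hL : IsLocalFinsler U L) (i : Fin n) :
    ContDiffOn ℝ ∞ (spray L i) (U ×ˢ {0}ᶜ) := by
  have hO := hL.isOpen_slit
  refine contDiffOn_const.mul (ContDiffOn.sum fun l _ => (hL.contDiffOn_fundInv i l).mul
    (ContDiffOn.sub (ContDiffOn.sum fun k _ => ?_) (contDiffOn_pdx hO hL.contDiffOn_sq l)))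
  exact (contDiffOn_pdy hO (contDiffOn_pdx hO hL.contDiffOn_sq k) l).mul (contDiffOn_snd_apply k)

theorem contDiffOn_sprayVec (hL : IsLocalFinsler U L) :
    ContDiffOn ℝ ∞ (sprayVec L) (U ×ˢ {0}ᶜ) :=
  contDiffOn_euclidean.2 hL.contDiffOn_spray

theorem contDiffOn_nonlin (hL : IsLocalFinsler U L) (i j : Fin n) :
    ContDiffOn ℝ ∞ (nonlin L i j) (U ×ˢ {0}ᶜ) :=
  contDiffOn_const.mul (contDiffOn_pdy hL.isOpen_slit (hL.contDiffOn_spray i) j)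

theorem contDiffOn_riemann (hL : IsLocalFinsler U L) (i k : Fin n) :
    ContDiffOn ℝ ∞ (riemann L i k) (U ×ˢ {0}ᶜ) := by
  have hO := hL.isOpen_slit
  have hG := hL.contDiffOn_spray
  have hGy := fun i j => contDiffOn_pdy hO (hG i) j
  refine (((contDiffOn_pdx hO (hG i) k).sub (contDiffOn_const.mul (ContDiffOn.sum fun j _ => ?_))).sub
    (contDiffOn_const.mul (ContDiffOn.sum fun j _ => ?_))).add
    (contDiffOn_const.mul (ContDiffOn.sum fun j _ => ?_))
  · exact (hGy i j).mul (hGy j k)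
  · exact (contDiffOn_snd_apply j).mul (contDiffOn_pdx hO (hGy i k) j)
  · exact (hG j).mul (contDiffOn_pdy hO (hGy i j) k)

theorem contDiffOn_ricciSq (hL : IsLocalFinsler U L) :
    ContDiffOn ℝ ∞ (ricciSq L) (U ×ˢ {0}ᶜ) :=
  ContDiffOn.sum fun i _ => hL.contDiffOn_riemann i i

theorem contDiffOn_ricci (hL : IsLocalFinsler U L) (i j : Fin n) :
    ContDiffOn ℝ ∞ (ricci L i j) (U ×ˢ {0}ᶜ) :=
  contDiffOn_const.mul (contDiffOn_pdy hL.isOpen_slit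
    (contDiffOn_pdy hL.isOpen_slit hL.contDiffOn_ricciSq i) j)

theorem contDiffAt_of (hL : IsLocalFinsler U L) {W : Type*} [NormedAddCommGroup W]
    [NormedSpace ℝ W] {f : E n × E n → W} (hf : ContDiffOn ℝ ∞ f (U ×ˢ {0}ᶜ))
    (hz : z ∈ U ×ˢ {0}ᶜ) (m : ℕ) : ContDiffAt ℝ m f z :=
  (hf.contDiffAt (hL.isOpen_slit.mem_nhds hz)).of_le (by exact_mod_cast le_top)

theorem differentiableAt_of (hL : IsLocalFinsler U L) {W : Type*} [NormedAddCommGroup W]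
    [NormedSpace ℝ W] {f : E n × E n → W} (hf : ContDiffOn ℝ ∞ f (U ×ˢ {0}ᶜ))
    (hz : z ∈ U ×ˢ {0}ᶜ) : DifferentiableAt ℝ f z :=
  (hf.contDiffAt (hL.isOpen_slit.mem_nhds hz)).differentiableAt (by simp)

/-! #### Homogeneity -/

theorem isHomog_sq (hL : IsLocalFinsler U L) : IsHomog 2 fun w => L w ^ 2 := by
  have := hL.homog.mul hL.homog
  simp only [← sq] at this
  exact this

theorem isHomog_energy (hL : IsLocalFinsler U L) : IsHomog 2 (energy L) :=
  hL.isHomog_sq.const_mul _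

theorem isHomog_fundTensor (hL : IsLocalFinsler U L) (i j : Fin n) :
    IsHomog 0 fun w => fundTensor L w i j :=
  (hL.isHomog_energy.pdy i).pdy j

theorem isHomog_fundInv (hL : IsLocalFinsler U L) (i j : Fin n) :
    IsHomog 0 fun w => fundInv L w i j := fun x y t ht => by
  have : fundTensor L (x, t • y) = fundTensor L (x, y) := by
    ext k l
    simpa using hL.isHomog_fundTensor k l x y t ht
  simp [fundInv, this]

theorem isHomog_spray (hL : IsLocalFinsler U L) (i : Fin n) : IsHomog 2 (spray L i) := by
  refine IsHomog.const_mul _ (IsHomog.sum fun l => ?_)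
  rw [← zero_add (2 : ℤ)]
  refine (hL.isHomog_fundInv i l).mul (IsHomog.sub (IsHomog.sum fun k => ?_) ?_)
  · exact ((hL.isHomog_sq.pdx k).pdy l).mul (IsHomog.snd_apply k)
  · exact hL.isHomog_sq.pdx l

theorem isHomog_nonlin (hL : IsLocalFinsler U L) (i j : Fin n) : IsHomog 1 (nonlin L i j) :=
  ((hL.isHomog_spray i).pdy j).const_mul _

theorem isHomog_riemann (hL : IsLocalFinsler U L) (i k : Fin n) : IsHomog 2 (riemann L i k) := by
  have hG := hL.isHomog_spray
  have hGy := fun i j => (hG i).pdy j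
  refine ((((hG i).pdx k).sub (IsHomog.const_mul _ (IsHomog.sum fun j => ?_))).sub
    (IsHomog.const_mul _ (IsHomog.sum fun j => ?_))).add
    (IsHomog.const_mul _ (IsHomog.sum fun j => ?_))
  · exact (hGy i j).mul (hGy j k)
  · exact (IsHomog.snd_apply j).mul ((hGy i k).pdx j)
  · exact (hG j).mul ((hGy i j).pdy k)

theorem isHomog_ricciSq (hL : IsLocalFinsler U L) : IsHomog 2 (ricciSq L) :=
  IsHomog.sum fun i => hL.isHomog_riemann i i

/-- `Ric_ij yⁱ yʲ` is `F² Ric`. -/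
theorem sum_ricci_mul_mul (hL : IsLocalFinsler U L) (hz : z ∈ U ×ˢ {0}ᶜ) :
    ∑ j, ∑ k, ricci L j k z * z.2 j * z.2 k = ricciSq L z := by
  have hO := hL.isOpen_slit
  have hH := hL.contDiffOn_ricciSq
  have h1 := hL.isHomog_ricciSq.sum_mul_pdy (hL.differentiableAt_of hH hz)
  -- Euler's theorem is used twice: `F² Ric` has degree two and its first velocity derivatives have
  -- degree one.
  have h2 := fun j => (hL.isHomog_ricciSq.pdy j).sum_mul_pdy
    (hL.differentiableAt_of (contDiffOn_pdy hO hH j) hz)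
  have h3 : ∀ j, ∑ k, ricci L j k z * z.2 j * z.2 k = (1 / 2) * (z.2 j * pdy j (ricciSq L) z) := by
    intro j
    have h4 := h2 j
    norm_num at h4
    rw [← h4, Finset.mul_sum, Finset.mul_sum]
    refine Finset.sum_congr rfl fun k _ => ?_
    rw [ricci]; ring
  simp only [h3]
  rw [← Finset.mul_sum, h1]
  push_cast; ring

theorem sum_nonlin_mul (hL : IsLocalFinsler U L) (hz : z ∈ U ×ˢ {0}ᶜ) (i : Fin n) :
    ∑ k, z.2 k * nonlin L i k z = spray L i z := by
  have h1 := (hL.isHomog_spray i).sum_mul_pdy (hL.differentiableAt_of (hL.contDiffOn_spray i) hz)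
  have h2 : ∑ k, z.2 k * nonlin L i k z = (1 / 2) * ∑ k, z.2 k * pdy k (spray L i) z := by
    rw [Finset.mul_sum]
    refine Finset.sum_congr rfl fun k _ => ?_
    rw [nonlin]; ring
  rw [h2, h1]; push_cast; ring

/-! #### The geodesic spray -/

/-- Invertibility of `g` clears `g⁻¹` from the definition of the spray; what remains is the
Euler–Lagrange equation of the energy in components. -/
theorem sum_fundTensor_mul_spray (hL : IsLocalFinsler U L) (hz : z ∈ U ×ˢ {0}ᶜ) (l : Fin n) :
    ∑ i, fundTensor L z l i * spray L i z =
      (∑ k, z.2 k * pdx k (pdy l (energy L)) z) - pdx l (energy L) z := by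
  set b : Fin n → ℝ := fun l =>
    (∑ k, z.2 k * pdx k (pdy l (energy L)) z) - pdx l (energy L) z with hb
  have hC : ContDiffAt ℝ 2 (energy L) z := hL.contDiffAt_of hL.contDiffOn_energy hz 2
  have h1 : ∀ i, spray L i z = (fundInv L z).mulVec b i := by
    intro i
    rw [spray, Finset.mul_sum, Matrix.mulVec, dotProduct]
    refine Finset.sum_congr rfl fun m _ => ?_
    have h2 : ∀ k, pdx k (fun w => L w ^ 2) = fun w => 2 * pdx k (energy L) w := fun k => by
      rw [sq_eq_two_mul_energy]; funext w; rw [pdx_const_mul]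
    simp only [h2, pdy_const_mul, hb, pdy_pdx_comm hC]
    have h3 : ∑ k, 2 * pdx k (pdy m (energy L)) z * z.2 k =
        2 * ∑ k, z.2 k * pdx k (pdy m (energy L)) z := by
      rw [Finset.mul_sum]
      exact Finset.sum_congr rfl fun k _ => by ring
    rw [h3]; ring
  have h4 : (fundTensor L z).mulVec ((fundInv L z).mulVec b) = b := by
    rw [Matrix.mulVec_mulVec, fundInv, Matrix.mul_nonsing_inv _ (hL.det_ne_zero hz).isUnit,
      Matrix.one_mulVec]
  have h5 := congrFun h4 l
  rw [Matrix.mulVec, dotProduct] at h5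
  simp only [h1]
  exact h5

theorem pair_eq (a b : E n) : (a, b) = (a, (0 : E n)) + ((0 : E n), b) := by simp

theorem fderiv_pdy_energy (hL : IsLocalFinsler U L) (hz : z ∈ U ×ˢ {0}ᶜ) (l : Fin n) (u : E n) :
    fderiv ℝ (fderiv ℝ (energy L)) z (0, u) (0, EuclideanSpace.single l 1) =
      ∑ i, fundTensor L z l i * u i := by
  rw [← fderiv_pdy (hL.contDiffAt_of hL.contDiffOn_energy hz 2), ← sum_mul_pdy]
  exact Finset.sum_congr rfl fun i _ => mul_comm _ _

/-- The Euler–Lagrange equation of the energy, satisfied by the geodesic spray. -/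
theorem euler_lagrange (hL : IsLocalFinsler U L) (hz : z ∈ U ×ˢ {0}ᶜ) (w : E n) :
    fderiv ℝ (fderiv ℝ (energy L)) z (z.2, -sprayVec L z) (0, w) =
      fderiv ℝ (energy L) z (w, 0) := by
  have hC : ContDiffAt ℝ 2 (energy L) z := hL.contDiffAt_of hL.contDiffOn_energy hz 2
  have key : ∀ l, fderiv ℝ (fderiv ℝ (energy L)) z (z.2, -sprayVec L z)
      (0, EuclideanSpace.single l 1) = pdx l (energy L) z := by
    intro l
    rw [pair_eq, map_add, add_apply, hL.fderiv_pdy_energy hz, ← fderiv_pdy hC, ← sum_mul_pdx]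
    have := hL.sum_fundTensor_mul_spray hz l
    have h2 : ∑ i, fundTensor L z l i * (-sprayVec L z) i =
        -∑ i, fundTensor L z l i * spray L i z := by
      rw [← Finset.sum_neg_distrib]
      exact Finset.sum_congr rfl fun i _ => by simp [sprayVec]
    rw [h2, this]; ring
  rw [← sum_mul_pdx]
  simp only [← key]
  have h : ((0 : E n), w) = ContinuousLinearMap.inr ℝ (E n) (E n) w := by simp
  rw [h]
  nth_rw 1 [← sum_smul_single w]
  simp only [map_sum, map_smul, smul_eq_mul, ContinuousLinearMap.inr_apply]

/-- Strong convexity in the form of the nondegeneracy hypothesis of `spray_tangentLift`. -/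
theorem eq_zero_of_hessian (hL : IsLocalFinsler U L) (hz : z ∈ U ×ˢ {0}ᶜ) (u : E n)
    (hu : ∀ w, fderiv ℝ (fderiv ℝ (energy L)) z (0, u) (0, w) = 0) : u = 0 := by
  have h : (fundTensor L z).mulVec u.ofLp = 0 := by
    funext l
    rw [Matrix.mulVec, dotProduct, ← hL.fderiv_pdy_energy hz, hu]; rfl
  have := Matrix.eq_zero_of_mulVec_eq_zero (hL.det_ne_zero hz) h
  ext i
  exact congrFun this i

/-- Matches the invariant form of the curvature with its components. The derivative along `(y, -G)`
in `sprayCurv` merges the last two sums of `riemann`. -/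
theorem sprayCurv_apply_single (hL : IsLocalFinsler U L) (hz : z ∈ U ×ˢ {0}ᶜ) (i k : Fin n) :
    sprayCurv (sprayVec L) z (EuclideanSpace.single k 1) i = riemann L i k z := by
  have hG := hL.contDiffOn_spray
  have hGi : ∀ j, ContDiffAt ℝ 2 (spray L j) z := fun j => hL.contDiffAt_of (hG j) hz 2
  have hV : ContDiffAt ℝ 2 (sprayVec L) z := hL.contDiffAt_of hL.contDiffOn_sprayVec hz 2
  have e1 : ∀ i, ∀ᶠ w in 𝓝 z, ∀ u, fderiv ℝ (sprayVec L) w u i = fderiv ℝ (spray L i) w u := by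
    intro i
    filter_upwards [hL.isOpen_slit.mem_nhds hz] with w hw u
    have h1 := (hL.differentiableAt_of hL.contDiffOn_sprayVec hw).hasFDerivAt
    have h2 : HasFDerivAt (spray L i) _ w :=
      (EuclideanSpace.proj (𝕜 := ℝ) i : E n →L[ℝ] ℝ).hasFDerivAt.comp w h1
    rw [h2.fderiv]; rfl
  have e2 : ∀ i u v, fderiv ℝ (fderiv ℝ (sprayVec L)) z u v i =
      fderiv ℝ (fderiv ℝ (spray L i)) z u v := by
    intro i u v
    have hD : DifferentiableAt ℝ (fderiv ℝ (sprayVec L)) z :=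
      (hV.fderiv_right (m := 1) (by norm_num)).differentiableAt (by norm_num)
    have hDi : DifferentiableAt ℝ (fderiv ℝ (spray L i)) z :=
      ((hGi i).fderiv_right (m := 1) (by norm_num)).differentiableAt (by norm_num)
    have h1 := (EuclideanSpace.proj (𝕜 := ℝ) i : E n →L[ℝ] ℝ).hasFDerivAt.comp z
      (hD.hasFDerivAt.clm_apply (hasFDerivAt_const v z))
    have h2 := hDi.hasFDerivAt.clm_apply (hasFDerivAt_const v z)
    have h3 := (h2.congr_of_eventuallyEq ((e1 i).mono fun w hw => hw v)).unique h1
    have h4 := DFunLike.congr_fun h3 u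
    simpa using h4.symm
  have e1' := fun i => (e1 i).self_of_nhds
  rw [sprayCurv_apply]
  simp only [PiLp.sub_apply, PiLp.smul_apply, smul_eq_mul, e1', e2]
  rw [pair_eq z.2, map_add, add_apply, ← fderiv_pdy (hGi i), ← sum_mul_pdx _ z z.2,
    (((hGi i).isSymmSndFDerivAt (by simp)).eq (0, -sprayVec L z) (0, EuclideanSpace.single k 1)),
    ← sum_mul_pdy _ z (fderiv ℝ (sprayVec L) z (0, EuclideanSpace.single k 1))]
  have h5 : ∀ v, fderiv ℝ (fderiv ℝ (spray L i)) z (0, EuclideanSpace.single k 1) (0, v) =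
      ∑ j, v j * pdy k (pdy j (spray L i)) z := by
    intro v
    have h : ((0 : E n), v) = ContinuousLinearMap.inr ℝ (E n) (E n) v := by simp
    rw [h]
    nth_rw 1 [← sum_smul_single v]
    simp only [map_sum, map_smul, smul_eq_mul, ContinuousLinearMap.inr_apply]
    refine Finset.sum_congr rfl fun j _ => ?_
    rw [pdy, fderiv_pdy (hGi i)]
  rw [h5, riemann]
  have h6 : ∑ j, (-sprayVec L z) j * pdy k (pdy j (spray L i)) z =
      -∑ j, spray L j z * pdy k (pdy j (spray L i)) z := by
    rw [← Finset.sum_neg_distrib]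
    exact Finset.sum_congr rfl fun i _ => by simp [sprayVec]
  have h7 : ∑ j, (fderiv ℝ (sprayVec L) z (0, EuclideanSpace.single k 1)) j * pdy j (spray L i) z =
      ∑ j, pdy j (spray L i) z * pdy k (spray L j) z :=
    Finset.sum_congr rfl fun j _ => by rw [e1' j, mul_comm]; rfl
  rw [h6, h7]
  simp only [pdx]
  ring

/-- As the trace of an endomorphism, `F² Ric` becomes insensitive to the choice of basis. -/
theorem ricciSq_eq_trace (hL : IsLocalFinsler U L) (hz : z ∈ U ×ˢ {0}ᶜ) :
    ricciSq L z = LinearMap.trace ℝ (E n) (sprayCurv (sprayVec L) z).toLinearMap := by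
  rw [LinearMap.trace_eq_matrix_trace ℝ (EuclideanSpace.basisFun (Fin n) ℝ).toBasis, Matrix.trace,
    ricciSq]
  refine Finset.sum_congr rfl fun i _ => ?_
  simp [LinearMap.toMatrix_apply, hL.sprayCurv_apply_single hz]

end IsLocalFinsler

/-- The trace of the Riemann curvature does not depend on the coordinates. -/
theorem ricciSq_tangentLift {U U' : Set (E n)} {L L' : E n × E n → ℝ} (hL : IsLocalFinsler U L)
    (hL' : IsLocalFinsler U' L') {φ : E n → E n} {z : E n × E n} (hz : z ∈ U ×ˢ {0}ᶜ)
    (hz' : tangentLift φ z ∈ U' ×ˢ {0}ᶜ) (hφ : ContDiffAt ℝ ∞ φ z.1)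
    (hbij : ∀ᶠ x in 𝓝 z.1, Function.Bijective (fderiv ℝ φ x))
    (heq : L =ᶠ[𝓝 z] L' ∘ tangentLift φ) :
    ricciSq L' (tangentLift φ z) = ricciSq L z := by
  have hφ4 : ContDiffAt ℝ 4 φ z.1 := hφ.of_le (by
    have h : ∀ m : ℕ, (m : WithTop ℕ∞) ≤ ∞ := fun m => by exact_mod_cast le_top
    exact_mod_cast h 4)
  have hcont : ContinuousAt (tangentLift φ) z :=
    (hasFDerivAt_tangentLift (hφ4.differentiableAt (by norm_num))
      ((hφ4.fderiv_right (m := 3) (by norm_num)).differentiableAt (by norm_num))).1.continuousAt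
  -- The law is needed on a neighbourhood of `z`, not only at `z`, because the curvature
  -- differentiates the spray twice.
  have hspray : ∀ᶠ z' in 𝓝 z, sprayVec L' (tangentLift φ z') =
      fderiv ℝ φ z'.1 (sprayVec L z') - fderiv ℝ (fderiv ℝ φ) z'.1 z'.2 z'.2 := by
    have h4 : ∀ᶠ z' in 𝓝 z, ContDiffAt ℝ 4 φ z'.1 :=
      eventually_comp_fst (hφ4.eventually (by simp))
    filter_upwards [h4, eventually_comp_fst hbij, heq.eventuallyEq_nhds,
      hL.isOpen_slit.mem_nhds hz, hcont.eventually (hL'.isOpen_slit.mem_nhds hz')]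
      with w hw hb he hwU hwU'
    refine spray_tangentLift (h := energy L) (h' := energy L') (hw.of_le (by norm_num))
      (hL.contDiffAt_of hL.contDiffOn_energy hwU 2) (hL'.contDiffAt_of hL'.contDiffOn_energy hwU' 2)
      ?_ (hL.euler_lagrange hwU) (hL'.euler_lagrange hwU') (hL'.eq_zero_of_hessian hwU')
      hb.surjective
    filter_upwards [he] with v hv
    simp only [energy, hv, Function.comp_apply]
  have hR := sprayCurv_tangentLift hφ4 (hL.contDiffAt_of hL.contDiffOn_sprayVec hz 2)
    (hL'.contDiffAt_of hL'.contDiffOn_sprayVec hz' 2) hspray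
  rw [hL'.ricciSq_eq_trace hz', hL.ricciSq_eq_trace hz]
  let A : E n ≃ₗ[ℝ] E n :=
    LinearEquiv.ofBijective (fderiv ℝ φ z.1).toLinearMap hbij.self_of_nhds
  -- The two curvatures are conjugate by the differential of `φ`, hence have the same trace.
  rw [← LinearMap.trace_conj' (sprayCurv (sprayVec L) z).toLinearMap A]
  congr 1
  ext1 v
  obtain ⟨w, rfl⟩ := A.surjective v
  rw [LinearEquiv.conj_apply_apply, A.symm_apply_apply]
  exact hR w

end LocalFinsler

/-! ### Parallel tensors and differentiation along the spray -/

section Parallel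

variable {n : ℕ} {U : Set (E n)} {L : E n × E n → ℝ} {z : E n × E n}

namespace IsLocalFinsler

/-- The horizontal derivative in the direction of the velocity is the derivative along the spray. -/
theorem sum_mul_hder (hL : IsLocalFinsler U L) (hz : z ∈ U ×ˢ {0}ᶜ) (f : E n × E n → ℝ) :
    ∑ k, z.2 k * hder L k f z = fderiv ℝ f z (z.2, -sprayVec L z) := by
  rw [pair_eq, map_add, ← sum_mul_pdx, ← sum_mul_pdy]
  simp only [hder, mul_sub, Finset.sum_sub_distrib]
  rw [sub_eq_add_neg]
  congr 1
  simp only [Finset.mul_sum]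
  rw [Finset.sum_comm, ← Finset.sum_neg_distrib]
  refine Finset.sum_congr rfl fun l _ => ?_
  have : (-sprayVec L z) l = -∑ k, z.2 k * nonlin L l k z := by
    rw [hL.sum_nonlin_mul hz]; rfl
  rw [this, neg_mul, Finset.sum_mul]
  exact congrArg _ (Finset.sum_congr rfl fun k _ => by ring)

/-- The horizontal coefficients of the Berwald connection, contracted twice with the velocity. -/
theorem sum_berwald_mul_mul (hL : IsLocalFinsler U L) (hz : z ∈ U ×ˢ {0}ᶜ) (i : Fin n) :
    ∑ j, ∑ k, (berwald L).hor i j k z * z.2 j * z.2 k = spray L i z := by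
  rw [← hL.sum_nonlin_mul hz]
  refine Finset.sum_congr rfl fun j _ => ?_
  have h := (hL.isHomog_nonlin i j).sum_mul_pdy (hL.differentiableAt_of (hL.contDiffOn_nonlin i j) hz)
  push_cast at h
  rw [one_mul] at h
  rw [← h, Finset.mul_sum]
  exact Finset.sum_congr rfl fun k _ => by simp only [berwald]; ring

theorem fundTensor_symm (hL : IsLocalFinsler U L) (hz : z ∈ U ×ˢ {0}ᶜ) (i j : Fin n) :
    fundTensor L z i j = fundTensor L z j i :=
  pdy_pdy_comm (hL.contDiffAt_of hL.contDiffOn_energy hz 2) i j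

theorem eventually_slit (hL : IsLocalFinsler U L) (hz : z ∈ U ×ˢ {0}ᶜ) :
    ∀ᶠ w in 𝓝 z, w ∈ U ×ˢ ({0}ᶜ : Set (E n)) := hL.isOpen_slit.mem_nhds hz

theorem pdy_fundTensor_symm (hL : IsLocalFinsler U L) (hz : z ∈ U ×ˢ {0}ᶜ) (i j l : Fin n) :
    pdy l (fun w => fundTensor L w i j) z = pdy j (fun w => fundTensor L w i l) z :=
  pdy_pdy_comm (hL.contDiffAt_of
    (contDiffOn_pdy hL.isOpen_slit hL.contDiffOn_energy i) hz 2) j l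

theorem pdy_congr {f g : E n × E n → ℝ} (h : f =ᶠ[𝓝 z] g) (l : Fin n) : pdy l f z = pdy l g z := by
  rw [pdy, pdy, h.fderiv_eq]

theorem pdx_congr {f g : E n × E n → ℝ} (h : f =ᶠ[𝓝 z] g) (l : Fin n) : pdx l f z = pdx l g z := by
  rw [pdx, pdx, h.fderiv_eq]

theorem hder_congr {f g : E n × E n → ℝ} (h : f =ᶠ[𝓝 z] g) (l : Fin n) :
    hder L l f z = hder L l g z := by
  simp only [hder, pdx_congr h, pdy_congr h]

/-- The Cartan tensor contracted with the velocity vanishes. -/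
theorem sum_pdy_fundTensor_mul (hL : IsLocalFinsler U L) (hz : z ∈ U ×ˢ {0}ᶜ) (i l : Fin n) :
    ∑ j, pdy l (fun w => fundTensor L w i j) z * z.2 j = 0 := by
  have h := (hL.isHomog_fundTensor i l).sum_mul_pdy
    (hL.differentiableAt_of (hL.contDiffOn_fundTensor i l) hz)
  push_cast at h
  rw [zero_mul] at h
  rw [← h]
  exact Finset.sum_congr rfl fun j _ => by rw [hL.pdy_fundTensor_symm hz, mul_comm]

/-- The vertical part of `δ/δxᵏ` drops out because the Cartan tensor is annihilated by the velocity.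
-/
theorem sum_hder_fundTensor_mul (hL : IsLocalFinsler U L) (hz : z ∈ U ×ˢ {0}ᶜ) (i k : Fin n) :
    ∑ j, hder L k (fun w => fundTensor L w i j) z * z.2 j =
      ∑ j, pdx k (fun w => fundTensor L w i j) z * z.2 j := by
  simp only [hder, sub_mul, Finset.sum_sub_distrib]
  rw [sub_eq_self]
  simp only [Finset.sum_mul]
  rw [Finset.sum_comm]
  refine Finset.sum_eq_zero fun l _ => ?_
  simp only [mul_assoc]
  rw [← Finset.mul_sum, hL.sum_pdy_fundTensor_mul hz, mul_zero]

/-- Euler's theorem for `∂²E/∂xᵏ∂yⁱ`, which has degree one in the velocity, `E` being the energy. -/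
theorem sum_pdx_fundTensor_mul (hL : IsLocalFinsler U L) (hz : z ∈ U ×ˢ {0}ᶜ) (i k : Fin n) :
    ∑ j, pdx k (fun w => fundTensor L w i j) z * z.2 j = pdx k (pdy i (energy L)) z := by
  have hE := hL.contDiffAt_of (contDiffOn_pdy hL.isOpen_slit hL.contDiffOn_energy i) hz 2
  have h1 := (hL.isHomog_energy.pdy i).pdx k |>.sum_mul_pdy (hL.differentiableAt_of
    (contDiffOn_pdx hL.isOpen_slit (contDiffOn_pdy hL.isOpen_slit hL.contDiffOn_energy i) k) hz)
  norm_num at h1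
  rw [← h1]
  exact Finset.sum_congr rfl fun j _ => by rw [pdy_pdx_comm hE, mul_comm]; rfl

theorem sum_pdx_fundTensor_mul_mul (hL : IsLocalFinsler U L) (hz : z ∈ U ×ˢ {0}ᶜ) (k : Fin n) :
    ∑ i, ∑ j, pdx k (fun w => fundTensor L w i j) z * z.2 i * z.2 j =
      2 * pdx k (energy L) z := by
  have hE := hL.contDiffAt_of hL.contDiffOn_energy hz 2
  have h1 := (hL.isHomog_energy.pdx k).sum_mul_pdy (hL.differentiableAt_of
    (contDiffOn_pdx hL.isOpen_slit hL.contDiffOn_energy k) hz)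
  push_cast at h1
  rw [← h1]
  refine Finset.sum_congr rfl fun i _ => ?_
  rw [pdy_pdx_comm hE, ← hL.sum_pdx_fundTensor_mul hz, Finset.mul_sum]
  exact Finset.sum_congr rfl fun j _ => by ring

/-- The horizontal coefficients of the Chern connection, contracted twice with the velocity. -/
theorem sum_chernGamma_mul_mul (hL : IsLocalFinsler U L) (hz : z ∈ U ×ˢ {0}ᶜ) (i : Fin n) :
    ∑ j, ∑ k, chernGamma L i j k z * z.2 j * z.2 k = spray L i z := by
  have hE := hL.contDiffAt_of hL.contDiffOn_energy hz 2
  set y := z.2 with hy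
  have hg : ∀ k i j, hder L k (fun w => fundTensor L w i j) z =
      hder L k (fun w => fundTensor L w j i) z := fun k i j =>
    hder_congr ((hL.eventually_slit hz).mono fun w hw => hL.fundTensor_symm hw i j) k
  have a1 : ∀ h, ∑ j, ∑ k, hder L k (fun w => fundTensor L w h j) z * y j * y k =
      ∑ k, pdx k (pdy h (energy L)) z * y k := by
    intro h
    rw [Finset.sum_comm]
    refine Finset.sum_congr rfl fun k _ => ?_
    rw [← Finset.sum_mul, hL.sum_hder_fundTensor_mul hz, hL.sum_pdx_fundTensor_mul hz]
  have a2 : ∀ h, ∑ j, ∑ k, hder L j (fun w => fundTensor L w k h) z * y j * y k =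
      ∑ k, pdx k (pdy h (energy L)) z * y k := by
    intro h
    rw [← a1, Finset.sum_comm]
    exact Finset.sum_congr rfl fun k _ => Finset.sum_congr rfl fun j _ => by rw [hg j k h]; ring
  have a3 : ∀ h, ∑ j, ∑ k, hder L h (fun w => fundTensor L w j k) z * y j * y k =
      2 * pdx h (energy L) z := by
    intro h
    rw [← hL.sum_pdx_fundTensor_mul_mul hz]
    refine Finset.sum_congr rfl fun j _ => ?_
    have e : ∀ f : Fin n → ℝ, ∑ k, f k * y j * y k = y j * ∑ k, f k * y k := fun f => by
      rw [Finset.mul_sum]; exact Finset.sum_congr rfl fun k _ => by ring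
    rw [e, e, hL.sum_hder_fundTensor_mul hz]
  -- The first two terms of `Γ` each contribute `yᵏ ∂²E/∂xᵏ∂yʰ` and the third `-2 ∂E/∂xʰ`. As `F² =
  -- 2E`, this is the bracket defining the spray.
  have b : ∀ h, ∑ j, ∑ k, (hder L k (fun w => fundTensor L w h j) z
      + hder L j (fun w => fundTensor L w k h) z
      - hder L h (fun w => fundTensor L w j k) z) * y j * y k =
      (∑ k, pdy h (pdx k fun w => L w ^ 2) z * y k) - pdx h (fun w => L w ^ 2) z := by
    intro h
    have h2 : ∀ k, pdx k (fun w => L w ^ 2) = fun w => 2 * pdx k (energy L) w := fun k => by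
      rw [sq_eq_two_mul_energy]; funext w; rw [pdx_const_mul]
    simp only [h2, pdy_const_mul, pdy_pdx_comm hE, add_mul, sub_mul, Finset.sum_add_distrib,
      Finset.sum_sub_distrib, a1, a2, a3]
    simp only [mul_assoc, ← Finset.mul_sum]
    ring
  simp only [spray, ← hy, ← b]
  simp only [chernGamma, Finset.mul_sum, Finset.sum_mul]
  rw [Finset.sum_congr rfl fun j _ => Finset.sum_comm, Finset.sum_comm]
  exact Finset.sum_congr rfl fun h _ => Finset.sum_congr rfl fun j _ =>
    Finset.sum_congr rfl fun k _ => by ring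

/-- If a 2-tensor `T` has vanishing horizontal covariant derivative for a connection whose
contracted coefficients are those of the spray, then `T_ij yⁱ yʲ` is constant along the spray. -/
theorem fderiv_contraction_eq_zero (hL : IsLocalFinsler U L) (hz : z ∈ U ×ˢ {0}ᶜ)
    {D : ConnCoeff n} {T : Fin n → Fin n → E n × E n → ℝ}
    (hT : ∀ i j, DifferentiableAt ℝ (T i j) z)
    (hD : ∀ i, ∑ j, ∑ k, D.hor i j k z * z.2 j * z.2 k = spray L i z)
    (hpar : ∀ k i j, hcov L D T k i j z = 0) :
    DifferentiableAt ℝ (fun w => ∑ i, ∑ j, T i j w * w.2 i * w.2 j) z ∧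
    fderiv ℝ (fun w => ∑ i, ∑ j, T i j w * w.2 i * w.2 j) z (z.2, -sprayVec L z) = 0 := by
  have hp : ∀ i : Fin n, HasFDerivAt (fun w : E n × E n => w.2 i)
      ((EuclideanSpace.proj (𝕜 := ℝ) i : E n →L[ℝ] ℝ).comp
        (ContinuousLinearMap.snd ℝ (E n) (E n))) z := fun i =>
    (EuclideanSpace.proj (𝕜 := ℝ) i : E n →L[ℝ] ℝ).hasFDerivAt.comp z hasFDerivAt_snd
  have hsum := HasFDerivAt.fun_sum (u := Finset.univ) fun i _ =>
    HasFDerivAt.fun_sum (u := Finset.univ) fun j _ =>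
      (((hT i j).hasFDerivAt.mul (hp i)).mul (hp j))
  have hsum' : HasFDerivAt (fun w => ∑ i, ∑ j, T i j w * w.2 i * w.2 j) _ z := hsum
  refine ⟨hsum'.differentiableAt, ?_⟩
  rw [hsum'.fderiv]
  set y := z.2 with hy
  -- Contracting the parallelism with `yᵏ` expresses the derivative of `T_ij` along the spray
  -- through connection coefficients.
  have c1 : ∀ i j, fderiv ℝ (T i j) z (y, -sprayVec L z) =
      ∑ k, y k * ((∑ r, T i r z * D.hor r j k z) + ∑ r, T r j z * D.hor r i k z) := by
    intro i j
    rw [← hL.sum_mul_hder hz]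
    refine Finset.sum_congr rfl fun k _ => ?_
    have := hpar k i j
    rw [hcov] at this
    congr 1
    linarith only [this]
  have c2 : ∀ i, ∑ j, y j * ∑ k, y k * ∑ r, T i r z * D.hor r j k z =
      ∑ r, T i r z * spray L r z := by
    intro i
    simp only [← hD, Finset.mul_sum]
    rw [Finset.sum_congr rfl fun j _ => Finset.sum_comm, Finset.sum_comm]
    exact Finset.sum_congr rfl fun _ _ => Finset.sum_congr rfl fun _ _ =>
      Finset.sum_congr rfl fun _ _ => by ring
  have c3 : ∀ j, ∑ i, y i * ∑ k, y k * ∑ r, T r j z * D.hor r i k z =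
      ∑ r, T r j z * spray L r z := by
    intro j
    simp only [← hD, Finset.mul_sum]
    rw [Finset.sum_congr rfl fun j _ => Finset.sum_comm, Finset.sum_comm]
    exact Finset.sum_congr rfl fun _ _ => Finset.sum_congr rfl fun _ _ =>
      Finset.sum_congr rfl fun _ _ => by ring
  -- The connection terms add up to `T(y, G) + T(G, y)`, which cancels the contribution of the
  -- velocity factors, whose derivative along the spray is `-G`.
  have d1 : ∑ i, ∑ j, fderiv ℝ (T i j) z (y, -sprayVec L z) * y i * y j =
      (∑ i, ∑ j, T i j z * y i * spray L j z) + ∑ i, ∑ j, T i j z * spray L i z * y j := by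
    have e1 : ∑ i, ∑ j, T i j z * y i * spray L j z =
        ∑ i, ∑ j, y i * (y j * ∑ k, y k * ∑ r, T i r z * D.hor r j k z) := by
      refine Finset.sum_congr rfl fun i _ => ?_
      rw [← Finset.mul_sum, c2, Finset.mul_sum]
      exact Finset.sum_congr rfl fun j _ => by ring
    have e2 : ∑ i, ∑ j, T i j z * spray L i z * y j =
        ∑ i, ∑ j, y j * (y i * ∑ k, y k * ∑ r, T r j z * D.hor r i k z) := by
      rw [Finset.sum_comm]
      conv_rhs => rw [Finset.sum_comm]
      refine Finset.sum_congr rfl fun j _ => ?_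
      rw [← Finset.mul_sum, c3, Finset.mul_sum]
      exact Finset.sum_congr rfl fun j _ => by ring
    rw [e1, e2, ← Finset.sum_add_distrib]
    refine Finset.sum_congr rfl fun i _ => ?_
    rw [← Finset.sum_add_distrib]
    refine Finset.sum_congr rfl fun j _ => ?_
    rw [c1]
    simp only [mul_add, Finset.sum_add_distrib]
    ring
  simp only [sum_apply, add_apply, smul_apply, ContinuousLinearMap.comp_apply,
    ContinuousLinearMap.coe_snd', smul_eq_mul, Pi.mul_apply, PiLp.proj_apply]
  have e0 : ∀ i, (-sprayVec L z) i = -spray L i z := fun i => rfl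
  calc _ = ∑ i, ∑ j, (fderiv ℝ (T i j) z (y, -sprayVec L z) * y i * y j
          - T i j z * y i * spray L j z - T i j z * spray L i z * y j) :=
        Finset.sum_congr rfl fun i _ => Finset.sum_congr rfl fun j _ => by
          rw [e0, e0, ← hy]; ring
    _ = 0 := by
        simp only [Finset.sum_sub_distrib, d1]
        ring

end IsLocalFinsler

end Parallel

/-! ### From charts to the manifold: constancy along geodesics -/

namespace FinslerStructure

variable {n : ℕ} {M : Type*} [TopologicalSpace M] [ChartedSpace (E n) M] [IsManifold (𝓡 n) ∞ M]
  (F : FinslerStructure n M) {e e' : OpenPartialHomeomorph M (E n)}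

theorem mem_maximalAtlas (he : e ∈ atlas (E n) M) : e ∈ IsManifold.maximalAtlas (𝓡 n) ∞ M :=
  IsManifold.subset_maximalAtlas he

theorem mfderiv_symm_injective (he : e ∈ atlas (E n) M) {x : E n} (hx : x ∈ e.target) :
    Function.Injective (mfderiv (𝓡 n) (𝓡 n) e.symm x) :=
  (mdifferentiable_of_mem_atlas (I := 𝓡 n) he).symm.mfderiv_injective hx

theorem loc_smul (x y : E n) {t : ℝ} (ht : 0 < t) : F.loc e (x, t • y) = t * F.loc e (x, y) := by
  exact (congrArg (fun v : E n => F.toFun ⟨e.symm x, v⟩)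
    ((mfderiv (𝓡 n) (𝓡 n) e.symm x).map_smul t y)).trans (F.homog _ _ t ht)

/-- In a chart, `F` is its composition with the tangent map of the inverse chart. That map is
smooth, and being injective on fibres it preserves the slit bundle. -/
theorem contDiffOn_loc (he : e ∈ atlas (E n) M) :
    ContDiffOn ℝ ∞ (F.loc e) (e.target ×ˢ {0}ᶜ) := by
  have h1 : ContMDiffOn (𝓡 n) (𝓡 n) ∞ e.symm e.target :=
    contMDiffOn_symm_of_mem_maximalAtlas (mem_maximalAtlas he)
  have h2 := h1.contMDiffOn_tangentMapWithin (m := ∞) (by simp) e.open_target.uniqueMDiffOn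
  -- The identity, read as a map between two model structures on `E n × E n`: that of a vector space
  -- and that of a product.
  have h3 : ContMDiff (M' := ModelProd (E n) (E n)) 𝓘(ℝ, E n × E n)
      ((𝓡 n).prod 𝓘(ℝ, E n)) ∞ (id : E n × E n → E n × E n) := by
    rw [← modelWithCornersSelf_prod]
    exact contMDiff_id (I := 𝓘(ℝ, E n × E n)) (M := E n × E n)
  have h4 : ContMDiff 𝓘(ℝ, E n × E n) (𝓡 n).tangent ∞
      (fun z : E n × E n => (⟨z.1, z.2⟩ : TangentBundle (𝓡 n) (E n))) :=
    (contMDiff_tangentBundleModelSpaceHomeomorph_symm (I := 𝓡 n)).comp h3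
  have h5 : ContMDiffOn 𝓘(ℝ, E n × E n) (𝓡 n).tangent ∞
      (fun z : E n × E n => tangentMapWithin (𝓡 n) (𝓡 n) e.symm e.target ⟨z.1, z.2⟩)
      (e.target ×ˢ {0}ᶜ) :=
    h2.comp h4.contMDiffOn (fun z hz => hz.1)
  have h6 : ∀ z ∈ e.target ×ˢ ({0}ᶜ : Set (E n)),
      tangentMapWithin (𝓡 n) (𝓡 n) e.symm e.target ⟨z.1, z.2⟩ =
        tangentMap (𝓡 n) (𝓡 n) e.symm ⟨z.1, z.2⟩ := fun z hz =>
    tangentMapWithin_eq_tangentMap (e.open_target.uniqueMDiffOn z.1 hz.1)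
      (mdifferentiableAt_atlas_symm he hz.1)
  have h7 := F.smooth.comp (h5.congr fun z hz => (h6 z hz).symm) (fun z hz h0 => hz.2
    (mfderiv_symm_injective he hz.1 (h0.trans (map_zero _).symm)))
  exact contMDiffOn_iff_contDiffOn.1 h7

theorem isLocalFinsler_loc (he : e ∈ atlas (E n) M) : IsLocalFinsler e.target (F.loc e) where
  isOpen := e.open_target
  smooth := F.contDiffOn_loc he
  homog := fun x y t ht => by rw [zpow_one]; exact F.loc_smul x y ht
  posDef := fun z hz => F.convex e he z.1 hz.1 z.2 hz.2

theorem contDiffAt_transition (he : e ∈ atlas (E n) M) (he' : e' ∈ atlas (E n) M) {x : E n}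
    (hx : x ∈ (e.symm.trans e').source) : ContDiffAt ℝ ∞ (e' ∘ e.symm) x := by
  rw [OpenPartialHomeomorph.trans_source, OpenPartialHomeomorph.symm_source] at hx
  exact contMDiffAt_iff_contDiffAt.1
    ((contMDiffAt_of_mem_maximalAtlas (mem_maximalAtlas he') hx.2).comp x
      (contMDiffAt_symm_of_mem_maximalAtlas (mem_maximalAtlas he) hx.1))

theorem bijective_fderiv_transition (he : e ∈ atlas (E n) M) (he' : e' ∈ atlas (E n) M) {x : E n}
    (hx : x ∈ (e.symm.trans e').source) :
    Function.Bijective (fderiv ℝ (e' ∘ e.symm) x) := by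
  have h := ((mdifferentiable_of_mem_atlas (I := 𝓡 n) he).symm.trans
    (mdifferentiable_of_mem_atlas (I := 𝓡 n) he')).mfderiv_bijective hx
  rw [mfderiv_eq_fderiv] at h
  exact h

/-- Chain rule for `e.symm = e'.symm ∘ (e' ∘ e.symm)`, valid near points of the overlap. -/
theorem loc_tangentLift (he : e ∈ atlas (E n) M) (he' : e' ∈ atlas (E n) M) {z : E n × E n}
    (hx : z.1 ∈ (e.symm.trans e').source) :
    F.loc e z = F.loc e' (tangentLift (e' ∘ e.symm) z) := by
  have hx' := hx
  rw [OpenPartialHomeomorph.trans_source, OpenPartialHomeomorph.symm_source] at hx'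
  -- All tangent spaces are the same type `E n`, so base points and vectors can be compared
  -- separately.
  have key : ∀ (p q : M) (v w : E n), p = q → v = w →
      F.toFun (⟨p, v⟩ : TangentBundle (𝓡 n) M) = F.toFun ⟨q, w⟩ := by
    rintro p q v w rfl rfl; rfl
  have hev : e.symm =ᶠ[𝓝 z.1] e'.symm ∘ (e' ∘ e.symm) := by
    filter_upwards [(e.symm.trans e').open_source.mem_nhds hx] with w hw
    rw [OpenPartialHomeomorph.trans_source] at hw
    exact (e'.left_inv hw.2).symm
  have hφ : MDifferentiableAt (𝓡 n) (𝓡 n) (e' ∘ e.symm) z.1 :=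
    ((contDiffAt_transition he he' hx).differentiableAt (by simp)).mdifferentiableAt
  have he's : MDifferentiableAt (𝓡 n) (𝓡 n) e'.symm ((e' ∘ e.symm) z.1) :=
    mdifferentiableAt_atlas_symm he' (e'.map_source hx'.2)
  refine key _ _ _ _ hev.eq_of_nhds ?_
  have h1 : (mfderiv (𝓡 n) (𝓡 n) e.symm z.1 : E n → E n) =
      (mfderiv (𝓡 n) (𝓡 n) (e'.symm ∘ (e' ∘ e.symm)) z.1 : E n → E n) := by
    have := hev.mfderiv_eq (I := 𝓡 n) (I' := 𝓡 n)
    exact congrArg (fun f : E n →L[ℝ] E n => (f : E n → E n)) this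
  have h2 := congrFun h1 z.2
  refine h2.trans ?_
  rw [mfderiv_comp z.1 he's hφ, mfderiv_eq_fderiv]
  rfl

variable {F} {γ : ℝ → M} {I : Set ℝ}

theorem IsArcLengthGeodesic.contDiffAt (hγ : F.IsArcLengthGeodesic γ I) (hI : IsOpen I) {s : ℝ}
    (hs : s ∈ I) (he : e ∈ atlas (E n) M) (hse : γ s ∈ e.source) : ContDiffAt ℝ 2 (e ∘ γ) s := by
  have h1 : ContMDiffAt (𝓡 n) (𝓡 n) 2 e (γ s) :=
    (contMDiffAt_of_mem_maximalAtlas (mem_maximalAtlas he) hse).of_le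
      (by
        have h : ∀ m : ℕ, (m : WithTop ℕ∞) ≤ ∞ := fun m => by exact_mod_cast le_top
        exact_mod_cast h 2)
  exact contMDiffAt_iff_contDiffAt.1 (h1.comp s (hγ.1.contMDiffAt (hI.mem_nhds hs)))

/-- Homogeneity forces `F` to vanish on zero vectors, while unit speed gives `F = 1`. Scaling by `2`
yields the contradiction `1 = 2`. -/
theorem IsArcLengthGeodesic.mem_slit (hγ : F.IsArcLengthGeodesic γ I) {s : ℝ}
    (hs : s ∈ I) (he : e ∈ atlas (E n) M) (hse : γ s ∈ e.source) :
    (e (γ s), deriv (e ∘ γ) s) ∈ e.target ×ˢ ({0}ᶜ : Set (E n)) := by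
  refine ⟨e.map_source hse, fun h0 => ?_⟩
  have h1 := (hγ.2 s hs e he hse).2
  rw [show deriv (e ∘ γ) s = 0 from h0] at h1
  have h2 := F.loc_smul (e := e) (e (γ s)) 0 (t := 2) (by norm_num)
  rw [smul_zero, h1] at h2
  norm_num at h2

theorem IsArcLengthGeodesic.ricciAlong_eq (hγ : F.IsArcLengthGeodesic γ I) {s : ℝ}
    (hs : s ∈ I) (he : e ∈ atlas (E n) M) (hse : γ s ∈ e.source) :
    F.ricciAlong γ e s = ricciSq (F.loc e) (e (γ s), deriv (e ∘ γ) s) :=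
  (F.isLocalFinsler_loc he).sum_ricci_mul_mul (hγ.mem_slit hs he hse)

/-- `Ric_jk x'ʲ x'ᵏ` does not depend on the chart. -/
theorem IsArcLengthGeodesic.ricciAlong_eq_ricciAlong (hγ : F.IsArcLengthGeodesic γ I)
    (hI : IsOpen I) {s : ℝ} (hs : s ∈ I) (he : e ∈ atlas (E n) M) (hse : γ s ∈ e.source)
    (he' : e' ∈ atlas (E n) M) (hse' : γ s ∈ e'.source) :
    F.ricciAlong γ e s = F.ricciAlong γ e' s := by
  rw [hγ.ricciAlong_eq hs he hse, hγ.ricciAlong_eq hs he' hse']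
  have hx : e (γ s) ∈ (e.symm.trans e').source := by
    rw [OpenPartialHomeomorph.trans_source, OpenPartialHomeomorph.symm_source]
    exact ⟨e.map_source hse, by simpa [e.left_inv hse] using hse'⟩
  have hnhds : ∀ᶠ x in 𝓝 (e (γ s)), x ∈ (e.symm.trans e').source :=
    (e.symm.trans e').open_source.mem_nhds hx
  have hcont : ContinuousAt γ s := (hγ.1.contMDiffAt (hI.mem_nhds hs)).continuousAt
  have hev : (e' ∘ γ) =ᶠ[𝓝 s] (e' ∘ e.symm) ∘ (e ∘ γ) := by
    filter_upwards [hcont.eventually (e.open_source.mem_nhds hse)] with t ht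
    simp [e.left_inv ht]
  have hd : deriv (e' ∘ γ) s = fderiv ℝ (e' ∘ e.symm) (e (γ s)) (deriv (e ∘ γ) s) := by
    rw [hev.deriv_eq]
    exact (((contDiffAt_transition he he' hx).differentiableAt (by simp)).hasFDerivAt.comp_hasDerivAt
      s ((hγ.contDiffAt hI hs he hse).differentiableAt (by norm_num)).hasDerivAt).deriv
  have hz : (e' (γ s), deriv (e' ∘ γ) s) =
      tangentLift (e' ∘ e.symm) (e (γ s), deriv (e ∘ γ) s) := by
    rw [hd]; simp [tangentLift, e.left_inv hse]
  have hmem := hγ.mem_slit hs he' hse'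
  rw [hz] at hmem ⊢
  refine (ricciSq_tangentLift (F.isLocalFinsler_loc he) (F.isLocalFinsler_loc he')
    (hγ.mem_slit hs he hse) hmem (contDiffAt_transition he he' hx)
    (hnhds.mono fun x hx => bijective_fderiv_transition he he' hx) ?_).symm
  have h8 : ∀ᶠ w : E n × E n in 𝓝 (e (γ s), deriv (e ∘ γ) s), w.1 ∈ (e.symm.trans e').source :=
    eventually_comp_fst hnhds
  filter_upwards [h8] with w hw using F.loc_tangentLift he he' hw

/-- A Ricci tensor that is horizontally parallel is constant along geodesics. -/
theorem IsArcLengthGeodesic.hasDerivAt_ricciAlong (hγ : F.IsArcLengthGeodesic γ I)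
    (hI : IsOpen I)
    (hpar : F.RicciHParallel cartan ∨ F.RicciHParallel chern ∨ F.RicciHParallel berwald)
    {s : ℝ} (hs : s ∈ I) (he : e ∈ atlas (E n) M) (hse : γ s ∈ e.source) :
    HasDerivAt (F.ricciAlong γ e) 0 s := by
  have hL := F.isLocalFinsler_loc he
  have hz := hγ.mem_slit hs he hse
  have hC := hγ.contDiffAt hI hs he hse
  set z : E n × E n := (e (γ s), deriv (e ∘ γ) s) with hzdef
  -- The Cartan and Chern connections share their horizontal coefficients, so one contraction
  -- identity serves both.
  obtain ⟨D, hD, hp⟩ : ∃ D : ConnCoeff n,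
      (∀ i, ∑ j, ∑ k, D.hor i j k z * z.2 j * z.2 k = spray (F.loc e) i z) ∧
      ∀ k i j, hcov (F.loc e) D (ricci (F.loc e)) k i j z = 0 := by
    rcases hpar with h | h | h
    · exact ⟨cartan _, hL.sum_chernGamma_mul_mul hz, h e he z.1 hz.1 z.2 hz.2⟩
    · exact ⟨chern _, hL.sum_chernGamma_mul_mul hz, h e he z.1 hz.1 z.2 hz.2⟩
    · exact ⟨berwald _, hL.sum_berwald_mul_mul hz, h e he z.1 hz.1 z.2 hz.2⟩
  obtain ⟨h1, h2⟩ := hL.fderiv_contraction_eq_zero hz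
    (fun i j => hL.differentiableAt_of (hL.contDiffOn_ricci i j) hz) hD hp
  have h3 : HasDerivAt (e ∘ γ) (deriv (e ∘ γ) s) s :=
    (hC.differentiableAt (by norm_num)).hasDerivAt
  have h4 : HasDerivAt (deriv (e ∘ γ)) (deriv (deriv (e ∘ γ)) s) s := by
    have h5 : ContDiffAt ℝ 1 (fderiv ℝ (e ∘ γ)) s := hC.fderiv_right (by norm_num)
    have h6 : ContDiffAt ℝ 1 (deriv (e ∘ γ)) s := h5.clm_apply contDiffAt_const
    exact (h6.differentiableAt (by norm_num)).hasDerivAt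
  -- The geodesic equation says that `(x, x')` is an integral curve of `(y, -G)`.
  have h7 : deriv (deriv (e ∘ γ)) s = -sprayVec (F.loc e) z := by
    ext i
    have := (hγ.2 s hs e he hse).1 i
    exact eq_neg_of_add_eq_zero_left this
  rw [h7] at h4
  have h8 := h1.hasFDerivAt.comp_hasDerivAt s (h3.prodMk h4)
  rw [h2] at h8
  exact h8

theorem IsArcLengthGeodesic.exists_ricciAlong_eq (hγ : F.IsArcLengthGeodesic γ I)
    (hIo : IsOpen I) (hIc : I.OrdConnected)
    (hpar : F.RicciHParallel cartan ∨ F.RicciHParallel chern ∨ F.RicciHParallel berwald) :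
    ∃ K : ℝ, ∀ s ∈ I, ∀ e ∈ atlas (E n) M, γ s ∈ e.source → F.ricciAlong γ e s = K := by
  -- The preferred chart at `γ t` may jump with `t`. Chart independence allows it to be replaced,
  -- near `s`, by the fixed chart at `γ s`.
  have hd : ∀ s ∈ I, HasDerivAt (fun t => F.ricciAlong γ (chartAt (E n) (γ t)) t) 0 s := by
    intro s hs
    refine (hγ.hasDerivAt_ricciAlong hIo hpar hs (chart_mem_atlas (E n) (γ s))
      (mem_chart_source (E n) (γ s))).congr_of_eventuallyEq ?_
    have hcont : ContinuousAt γ s := (hγ.1.contMDiffAt (hIo.mem_nhds hs)).continuousAt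
    filter_upwards [hIo.mem_nhds hs, hcont.eventually ((chartAt (E n) (γ s)).open_source.mem_nhds
      (mem_chart_source (E n) (γ s)))] with t ht hts
    exact hγ.ricciAlong_eq_ricciAlong hIo ht (chart_mem_atlas (E n) (γ t))
      (mem_chart_source (E n) (γ t)) (chart_mem_atlas (E n) (γ s)) hts
  obtain ⟨K, hK⟩ := hIo.exists_is_const_of_deriv_eq_zero hIc.isPreconnected
    (fun s hs => (hd s hs).differentiableAt.differentiableWithinAt) (fun s hs => (hd s hs).deriv)
  refine ⟨K, fun s hs e he hse => ?_⟩
  rw [← hK s hs]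
  exact hγ.ricciAlong_eq_ricciAlong hIo hs he hse (chart_mem_atlas (E n) (γ s))
    (mem_chart_source (E n) (γ s))

/-- Interface between the two halves: once the Ricci term is the constant `K`, only a fundamental
system of `y'' = -lam y` with Wronskian `w` has to be supplied. -/
theorem isProjectiveParameter_iff {K lam w : ℝ} {J : Set ℝ} {p y₁ y₂ d₁ d₂ : ℝ → ℝ}
    (hK : ∀ s ∈ I, ∀ e ∈ atlas (E n) M, γ s ∈ e.source → F.ricciAlong γ e s = K)
    (hJI : J ⊆ I) (hJ : IsOpen J) (hJc : J.OrdConnected)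
    (hlam : 2 / ((n : ℝ) - 1) * K = 2 * lam) (h1 : ∀ s, HasDerivAt y₁ (d₁ s) s)
    (h1' : ∀ s, HasDerivAt d₁ (-lam * y₁ s) s) (h2 : ∀ s, HasDerivAt y₂ (d₂ s) s)
    (h2' : ∀ s, HasDerivAt d₂ (-lam * y₂ s) s) (hc1 : ContDiff ℝ 3 y₁) (hc2 : ContDiff ℝ 3 y₂)
    (hw : w ≠ 0) (hW : ∀ s, y₁ s * d₂ s - d₁ s * y₂ s = w) :
    F.IsProjectiveParameter γ J p ↔ IsLinFracOf y₁ y₂ J p := by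
  constructor
  · rintro ⟨hp, hp', hS⟩
    refine isLinFracOf_of_schwarzian h1 h1' h2 h2' hw hW hJ hJc.isPreconnected hp hp'
      fun s hs => ?_
    rw [← hlam, ← hK s (hJI hs) _ (chart_mem_atlas (E n) (γ s)) (mem_chart_source (E n) (γ s))]
    exact hS s hs _ (chart_mem_atlas (E n) (γ s)) (mem_chart_source (E n) (γ s))
  · intro h
    obtain ⟨hp, hp', hS⟩ := schwarzian_of_isLinFracOf h1 h1' h2 h2' hc1 hc2 hw hW hJ h
    refine ⟨hp, hp', fun s hs e he hse => ?_⟩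
    rw [hS s hs, hK s (hJI hs) e he hse, hlam]

end FinslerStructure

end Finsler

/-! ### The theorem: fundamental solutions in the three cases -/

theorem proposition1 (n : ℕ) (hn : 2 ≤ n) {M : Type*} [TopologicalSpace M]
    [ChartedSpace (EuclideanSpace ℝ (Fin n)) M] [IsManifold (𝓡 n) ∞ M]
    (F : Finsler.FinslerStructure n M)
    (hpar : F.RicciParallel Finsler.cartan ∨ F.RicciHParallel Finsler.chern ∨
      F.RicciHParallel Finsler.berwald)
    (γ : ℝ → M) (I : Set ℝ) (hIo : IsOpen I) (hIc : I.OrdConnected)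
    (hγ : F.IsArcLengthGeodesic γ I) :
    ∃ K : ℝ,
      (∀ s ∈ I, ∀ e ∈ atlas (EuclideanSpace ℝ (Fin n)) M, γ s ∈ e.source →
        F.ricciAlong γ e s = K) ∧
      ∀ J : Set ℝ, J ⊆ I → IsOpen J → J.OrdConnected → ∀ p : ℝ → ℝ,
        (∀ c : ℝ, 0 < c → 2 / ((n : ℝ) - 1) * K = 2 * c ^ 2 →
          (F.IsProjectiveParameter γ J p ↔
            Finsler.IsLinFracOf (fun s => Real.cos (c * s)) (fun s => Real.sin (c * s)) J p)) ∧
        (∀ c : ℝ, 0 < c → 2 / ((n : ℝ) - 1) * K = -(2 * c ^ 2) →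
          (F.IsProjectiveParameter γ J p ↔
            Finsler.IsLinFracOf (fun s => Real.exp (c * s)) (fun s => Real.exp (-(c * s))) J p)) ∧
        (2 / ((n : ℝ) - 1) * K = 0 →
          (F.IsProjectiveParameter γ J p ↔
            Finsler.IsLinFracOf (fun _ => 1) (fun s => s) J p)) := by
  obtain ⟨K, hK⟩ := hγ.exists_ricciAlong_eq hIo hIc (hpar.imp_left And.left)
  refine ⟨K, hK, fun J hJI hJ hJc p => ⟨fun c hc h => ?_, fun c hc h => ?_, fun h => ?_⟩⟩
  · have hl : ∀ s : ℝ, HasDerivAt (fun s => c * s) c s := fun s => by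
      simpa using (hasDerivAt_id s).const_mul c
    -- The Wronskian is `c (cos² + sin²) = c`.
    refine Finsler.FinslerStructure.isProjectiveParameter_iff hK hJI hJ hJc (lam := c ^ 2) (w := c)
      (d₁ := fun s => -c * Real.sin (c * s)) (d₂ := fun s => c * Real.cos (c * s)) h
      (fun s => (hl s).cos.congr_deriv (by ring))
      (fun s => ((hl s).sin.const_mul (-c)).congr_deriv (by ring))
      (fun s => (hl s).sin.congr_deriv (by ring))
      (fun s => ((hl s).cos.const_mul c).congr_deriv (by ring))
      (by fun_prop) (by fun_prop) hc.ne' (fun s => ?_)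
    linear_combination c * Real.sin_sq_add_cos_sq (c * s)
  · have hl : ∀ s : ℝ, HasDerivAt (fun s => c * s) c s := fun s => by
      simpa using (hasDerivAt_id s).const_mul c
    -- The Wronskian is `-2c` because the two exponentials are mutually inverse.
    refine Finsler.FinslerStructure.isProjectiveParameter_iff hK hJI hJ hJc (lam := -c ^ 2)
      (w := -(2 * c)) (d₁ := fun s => c * Real.exp (c * s))
      (d₂ := fun s => -c * Real.exp (-(c * s))) (by rw [h]; ring)
      (fun s => (hl s).exp.congr_deriv (by ring))
      (fun s => ((hl s).exp.const_mul c).congr_deriv (by ring))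
      (fun s => (hl s).neg.exp.congr_deriv (by simp only [Pi.neg_apply]; ring))
      (fun s => ((hl s).neg.exp.const_mul (-c)).congr_deriv (by simp only [Pi.neg_apply]; ring))
      (by fun_prop) (by fun_prop) (by simpa using hc.ne') (fun s => ?_)
    have : Real.exp (c * s) * Real.exp (-(c * s)) = 1 := by rw [← Real.exp_add]; simp
    linear_combination (-(2 * c)) * this
  · refine Finsler.FinslerStructure.isProjectiveParameter_iff hK hJI hJ hJc (lam := 0) (w := 1)
      (d₁ := fun _ => 0) (d₂ := fun _ => 1) (by rw [h]; ring)
      (fun s => hasDerivAt_const s 1) (fun s => (hasDerivAt_const s 0).congr_deriv (by ring))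
      (fun s => hasDerivAt_id s) (fun s => (hasDerivAt_const s 1).congr_deriv (by ring))
      (by fun_prop) (by fun_prop) one_ne_zero (fun s => by ring)
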